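/- Setting. There are $n\ge 2$ nodes, each holding an opinion from a finite set $\Sigma$. The 3-majority dynamics proceeds in synchronous rounds: in each round every node, independently, samples three nodes uniformly at random (with repetition, itself allowed) and adopts the majority opinion of the three, taking the first sampled one if all three differ. An $F$-dynamic adversary, at the end of every round (round $0$, the initial configuration, included), sees the current configuration and the whole past of the process and may (possibly at random) replace the opinions of at most $F$ nodes by arbitrary elements of $\Sigma$; the next round starts from the resulting configuration. The opinions present in the initial configuration are called valid, and $k$ denotes their number. Theorem. Let $\alpha<1$ and $\beta>0$ be constants. There is a constant $\gamma>\beta$, depending only on $\alpha,\beta$, such that for every $d\in\mathbb N$ and $c>0$ there is a constant $C>0$, depending only on $\alpha,\beta,d,c$, with the following property. Let $n\ge 2$, let $\Sigma$ be any finite set, take any initial configuration with exactly $k\le n^{\alpha}$ opinions, and any $F$-dynamic adversary with $$F=\frac{\beta\sqrt n}{k^{5/2}\log n}.$$ Then with probability at least $1-C n^{-c}$ there are a round $$T\le C\,\bigl(k^2\sqrt{\log n}+k\log n\bigr)\,(k+\log n)$$ and a single valid opinion $m$ such that at the end of every round $t$ with $T\le t\le T+n^{d}$ (after the adversary's action)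 every opinion other than $m$ is held by at most $\gamma\sqrt n/k^{3/2}$ nodes, and all non-valid opinions together are held by at most $\gamma\sqrt n/k^{3/2}$ nodes. (Hence all but at most $\gamma\sqrt{n/k}$ nodes hold $m$.) -/

import Mathlib

open scoped Finset

noncomputable section

/-- A configuration of `n` nodes: every node holds an opinion from the set `S`. -/
abbrev Config (n : ℕ) (S : Type*) := Fin n → S

open Classical in
/-- The number of nodes that hold the opinion `i`. -/
def opinionSize {n : ℕ} {S : Type*} (x : Config n S) (i : S) : ℕ :=
  #{v : Fin n | x v = i}

/-- The opinions that are held by at least one node. If `x` is the initial configuration, these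
are the valid opinions. -/
def activeOpinions {n : ℕ} {S : Type*} (x : Config n S) : Set S := Set.range x

open Classical in
/-- The majority of three sampled opinions. If the three are pairwise different, it is the first
of them; for a uniform sample this has the same law as a uniform choice among the three. -/
def majority3 {S : Type*} (a b c : S) : S := if b = c then b else a

/-- One round of the 3-majority dynamics from the configuration `x`: every node samples three
nodes uniformly, independently and with repetition (itself allowed), and adopts the majority
of their opinions; all nodes do so simultaneously and independently. -/
def threeMajorityStep {n : ℕ} [NeZero n] {S : Type*} (x : Config n S) : PMF (Config n S) :=
  (PMF.uniformOfFintype (Fin n → Fin 3 → Fin n)).map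
    fun s v => majority3 (x (s v 0)) (x (s v 1)) (x (s v 2))

open Classical in
/-- An `F`-dynamic adversary. At the end of round `t`, when the nodes have realized the
configuration `c`, it sees the whole past (for every earlier round, the configuration before and
after its own intervention) and `c`, and it replaces the opinions of at most `F` nodes by
arbitrary ones. It may randomize. -/
structure DynamicAdversary (n : ℕ) (S : Type*) (F : ℝ) where
  act : (t : ℕ) → (Fin t → Config n S × Config n S) → Config n S → PMF (Config n S)
  card_changed_le : ∀ (t : ℕ) (past : Fin t → Config n S × Config n S) (c c' : Config n S),
    c' ∈ (act t past c).support → (#{v : Fin n | c' v ≠ c v} : ℝ) ≤ F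

/-- The law of the history of rounds `0, …, t` of the 3-majority dynamics against the
adversary `A`, started at `x₀`. Round `s` is recorded as the pair of the configurations before
and after the action of the adversary in that round; the next round of the dynamics starts from
the latter. -/
def historyLaw {n : ℕ} [NeZero n] {S : Type*} {F : ℝ} (A : DynamicAdversary n S F)
    (x₀ : Config n S) : (t : ℕ) → PMF (Fin (t + 1) → Config n S × Config n S)
  | 0 => (A.act 0 Fin.elim0 x₀).map fun y _ => (x₀, y)
  | t + 1 => (historyLaw A x₀ t).bind fun h =>
      (threeMajorityStep (h (Fin.last t)).2).bind fun c =>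
        (A.act (t + 1) h c).map fun c' => Fin.snoc (α := fun _ => Config n S × Config n S) h (c, c')

open Classical in
/-- `x` is an almost-consensus on the opinion `m`, with size threshold `θ` and initial
configuration `x₀`: every opinion other than `m` is small (held by at most `θ` nodes), and the
non-valid opinions are small even when taken together. -/
def IsAlmostConsensus {n : ℕ} {S : Type*} (θ : ℝ) (x₀ x : Config n S) (m : S) : Prop :=
  (∀ i : S, i ≠ m → (opinionSize x i : ℝ) ≤ θ) ∧
    (#{v : Fin n | x v ∉ activeOpinions x₀} : ℝ) ≤ θ

/-- The history `h` of rounds `0, …, N` reaches, within `B` rounds, a valid almost-consensus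
that is stable for `L` further rounds: for some round `T ≤ B` and some valid opinion `m`, there
is an almost-consensus on this same `m` at the end of each of the rounds `T, …, T + L`. -/
def ReachesStableAlmostConsensus {n N : ℕ} {S : Type*} (θ : ℝ) (x₀ : Config n S) (B : ℝ) (L : ℕ)
    (h : Fin (N + 1) → Config n S × Config n S) : Prop :=
  ∃ T : ℕ, (T : ℝ) ≤ B ∧ ∃ m ∈ activeOpinions x₀,
    ∀ t : Fin (N + 1), T ≤ (t : ℕ) → (t : ℕ) ≤ T + L → IsAlmostConsensus θ x₀ (h t).2 m

end

/-!
The proof tracks a shrinking set `A` of `j` competing valid opinions, outside of which there are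
only `O(√n)` nodes, until a single competitor is left. At most `O(k log n (k + log n))` rounds are
needed, so the term with `√(log n)` in the time bound is not.

*The smallest competitor.* Let `X` be the size of the smallest competitor and `y = n / j - X ≥ 0`
its distance below the average. As the sum of the squared shares of all opinions is at least
essentially `1 / j`, the size of this competitor after a round is dominated by a binomial variable
of mean `X (1 - y / n)`, up to the influence of the adversary. So `1 + X` shrinks by a factor
`1 - Ω(1 / j)` once `y` is of order `n / j`. Close to the average, the drift is weak, but there the
variance of order `X` makes `y ^ 2 + 10⁶ n` grow by a factor `1 + Ω(1 / j)`. Hence the square root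
of `10⁶ n / (y ^ 2 + 10⁶ n) * (1 + X)` shrinks in expectation by a factor `1 - Ω(1 / j)` in every
round, by the inequality of the arithmetic and the geometric mean. This is
`binE_sizePotential_le`. Only the minimum matters, so the identity of the smallest competitor may
change all the time; as the minimum never exceeds the average, `y` is reflected at `0`, and
what is needed there is a lower bound for the second moment of the lower half of the fluctuation.

*Dropping competitors.* When the smallest competitor is tiny, it leaves `A`. The potential takes
values between `n ^ (-1/2)` and `2 √n`, so with an extra factor `(2 n) ^ j` it does not increase
when this happens. The product, together with `δ` for every remaining round, where `δ` bounds the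
probability that the nodes outside `A` become too many in one round, is a supermartingale along
every history (`Tracking.exists_roundE_le_potential`), and it dominates the failure probability
(`Tracking.le_toOuterMeasure`).

*Few nodes outside.* If the adversary controls no node, nothing is ever outside `A`. Otherwise
`1 ≤ F` forces `k ^ 5 ≤ β ^ 2 n` for large `n`, and then the drift towards `A`, of relative size
`1 / (2 k)`, beats both the adversary and the fluctuations (`Tracking.isAdmissible_of_log_le`). With one
competitor left, the number of nodes outside becomes quadratically small within one round, up to
the action of the adversary, so it falls below `γ √n / k ^ (3 / 2)` for `γ = β + 1`.
-/

noncomputable section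

/-! ### Binomial expectations -/

/-- The expectation of `f N`, where `N` is binomial with parameters `n` and `q`, by recursion on
the number of trials. -/
def binE (q : ℝ) : ℕ → (ℕ → ℝ) → ℝ
  | 0, f => f 0
  | n + 1, f => q * binE q n (fun N => f (N + 1)) + (1 - q) * binE q n f

theorem binE_add (q : ℝ) (n : ℕ) (f g : ℕ → ℝ) :
    binE q n (fun N => f N + g N) = binE q n f + binE q n g := by
  induction n generalizing f g with
  | zero => rfl
  | succ n ih => simp only [binE, ih]; ring

theorem binE_const_mul (q : ℝ) (n : ℕ) (a : ℝ) (f : ℕ → ℝ) :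
    binE q n (fun N => a * f N) = a * binE q n f := by
  induction n generalizing f with
  | zero => rfl
  | succ n ih => simp only [binE, ih]; ring

theorem binE_const (q : ℝ) (n : ℕ) (a : ℝ) : binE q n (fun _ => a) = a := by
  induction n with
  | zero => rfl
  | succ n ih => simp only [binE, ih]; ring

theorem binE_mono {q : ℝ} (h0 : 0 ≤ q) (h1 : q ≤ 1) (n : ℕ) {f g : ℕ → ℝ}
    (h : ∀ N, f N ≤ g N) : binE q n f ≤ binE q n g := by
  induction n generalizing f g with
  | zero => exact h 0
  | succ n ih =>
    simp only [binE]
    have := mul_le_mul_of_nonneg_left (ih (f := fun N => f (N + 1)) fun N => h (N + 1)) h0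
    have := mul_le_mul_of_nonneg_left (ih h) (sub_nonneg.2 h1)
    linarith

theorem binE_mono_prob {q q' : ℝ} (h0 : 0 ≤ q) (hq : q ≤ q') (h1 : q' ≤ 1) (n : ℕ)
    {f : ℕ → ℝ} (hf : Monotone f) : binE q n f ≤ binE q' n f := by
  induction n generalizing f with
  | zero => exact le_rfl
  | succ n ih =>
    simp only [binE]
    have e1 := ih (f := fun N => f (N + 1)) fun a b hab => hf (by omega)
    have e2 := ih hf
    have e3 : binE q n f ≤ binE q n (fun N => f (N + 1)) :=
      binE_mono h0 (hq.trans h1) n fun N => hf (Nat.le_succ N)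
    nlinarith [mul_le_mul_of_nonneg_left e1 (h0.trans hq),
      mul_le_mul_of_nonneg_left e2 (sub_nonneg.2 h1), mul_nonneg (sub_nonneg.2 hq) (sub_nonneg.2 e3)]

theorem binE_shift_one (q : ℝ) (n : ℕ) (t : ℝ) :
    binE q n (fun N => (N : ℝ) + t) = n * q + t := by
  induction n generalizing t with
  | zero => simp [binE]
  | succ n ih =>
    have : (fun N : ℕ => ((N + 1 : ℕ) : ℝ) + t) = fun N : ℕ => (N : ℝ) + (1 + t) := by
      ext N; push_cast; ring
    simp only [binE, this, ih]; push_cast; ring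

theorem binE_shift_sq (q : ℝ) (n : ℕ) (t : ℝ) :
    binE q n (fun N => ((N : ℝ) + t) ^ 2) = (n * q + t) ^ 2 + n * q * (1 - q) := by
  induction n generalizing t with
  | zero => simp [binE]
  | succ n ih =>
    have : (fun N : ℕ => (((N + 1 : ℕ) : ℝ) + t) ^ 2) = fun N : ℕ => ((N : ℝ) + (1 + t)) ^ 2 := by
      ext N; push_cast; ring
    simp only [binE, this, ih]; push_cast; ring

theorem binE_shift_four (q : ℝ) (n : ℕ) (t : ℝ) :
    binE q n (fun N => ((N : ℝ) + t) ^ 4) = (n * q + t) ^ 4 + 6 * (n * q + t) ^ 2 * (n * q * (1 - q))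
      + 4 * (n * q + t) * (n * q * (1 - q) * (1 - 2 * q))
      + (3 * (n * q * (1 - q)) ^ 2 + n * q * (1 - q) * (1 - 6 * (q * (1 - q)))) := by
  induction n generalizing t with
  | zero => simp [binE]
  | succ n ih =>
    have : (fun N : ℕ => (((N + 1 : ℕ) : ℝ) + t) ^ 4) = fun N : ℕ => ((N : ℝ) + (1 + t)) ^ 4 := by
      ext N; push_cast; ring
    simp only [binE, this, ih]; push_cast; ring

/-- The expectation of a quartic polynomial without cubic term in the centred binomial variable. -/
theorem binE_centred_poly_le {q : ℝ} (h0 : 0 ≤ q) (h1 : q ≤ 1) (n : ℕ) (a b c d : ℝ) (hd : 0 ≤ d) :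
    binE q n (fun N => a + b * ((N : ℝ) - n * q) + c * ((N : ℝ) - n * q) ^ 2
        + d * ((N : ℝ) - n * q) ^ 4)
      ≤ a + c * (n * q * (1 - q)) + d * (3 * (n * q * (1 - q)) ^ 2 + n * q * (1 - q)) := by
  have e1 : binE q n (fun N => (N : ℝ) - n * q) = 0 := by
    simpa [sub_eq_add_neg] using binE_shift_one q n (-(n * q))
  have e2 : binE q n (fun N => ((N : ℝ) - n * q) ^ 2) = n * q * (1 - q) := by
    simpa [sub_eq_add_neg] using binE_shift_sq q n (-(n * q))
  have e4 : binE q n (fun N => ((N : ℝ) - n * q) ^ 4)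
      ≤ 3 * (n * q * (1 - q)) ^ 2 + n * q * (1 - q) := by
    have := binE_shift_four q n (-(n * q))
    simp only [← sub_eq_add_neg, sub_self] at this
    rw [this]
    have h3 : 0 ≤ q * (1 - q) := mul_nonneg h0 (sub_nonneg.2 h1)
    have h4 : (0 : ℝ) ≤ n * q * (1 - q) := by rw [mul_assoc]; positivity
    nlinarith [mul_nonneg h4 h3]
  simp only [binE_add, binE_const, binE_const_mul, e1, e2]
  nlinarith [mul_le_mul_of_nonneg_left e4 hd]

theorem binE_exp (q s : ℝ) (n : ℕ) :
    binE q n (fun N => Real.exp (s * N)) = (1 + q * (Real.exp s - 1)) ^ n := by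
  induction n with
  | zero => simp [binE]
  | succ n ih =>
    have : (fun N : ℕ => Real.exp (s * (N + 1 : ℕ))) =
        fun N : ℕ => Real.exp s * Real.exp (s * N) := by
      ext N; rw [← Real.exp_add]; push_cast; ring_nf
    simp only [binE, this, binE_const_mul, ih]; ring

open Classical in
/-- Chernoff's bound for the upper tail of the binomial law. -/
theorem binE_tail_le {q : ℝ} (h0 : 0 ≤ q) (h1 : q ≤ 1) (n : ℕ) {s : ℝ} (hs : 0 ≤ s) (u : ℝ) :
    binE q n (fun N => if u < N then 1 else 0)
      ≤ Real.exp (n * q * (Real.exp s - 1) - s * u) := by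
  have e1 : binE q n (fun N => if u < N then 1 else 0)
      ≤ binE q n (fun N => Real.exp (-(s * u)) * Real.exp (s * N)) := by
    refine binE_mono h0 h1 n fun N => ?_
    rw [← Real.exp_add]
    split_ifs with h
    · exact Real.one_le_exp (by nlinarith)
    · positivity
  refine e1.trans ?_
  rw [binE_const_mul, binE_exp, sub_eq_neg_add (_ * _) (s * u), Real.exp_add]
  refine mul_le_mul_of_nonneg_left ?_ (Real.exp_nonneg _)
  have h2 : 1 ≤ Real.exp s := Real.one_le_exp hs
  have : 1 + q * (Real.exp s - 1) ≤ Real.exp (q * (Real.exp s - 1)) := by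
    linarith [Real.add_one_le_exp (q * (Real.exp s - 1))]
  calc (1 + q * (Real.exp s - 1)) ^ n ≤ Real.exp (q * (Real.exp s - 1)) ^ n := by
        refine pow_le_pow_left₀ ?_ this n
        nlinarith
    _ = _ := by rw [← Real.exp_nat_mul]; ring_nf

open Classical in
/-- The number of successes among `n` independent uniform samples from a finite type is binomial. -/
theorem sum_card_filter_eq_binE {β : Type*} [Fintype β] [Nonempty β] (P : β → Prop) (n : ℕ)
    (f : ℕ → ℝ) :
    ∑ s : Fin n → β, f (#{v | P (s v)})
      = (Fintype.card β : ℝ) ^ n * binE ((#{b | P b} : ℝ) / Fintype.card β) n f := by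
  induction n generalizing f with
  | zero => simp [binE]
  | succ n ih =>
    have hc : (Fintype.card β : ℝ) ≠ 0 := by exact_mod_cast Fintype.card_ne_zero
    have e : ∑ s : Fin (n + 1) → β, f (#{v | P (s v)})
        = ∑ b : β, ∑ s : Fin n → β, f ((if P b then 1 else 0) + #{v | P (s v)}) := by
      rw [← Fintype.sum_prod_type', ← (Fin.consEquiv fun _ => β).sum_comp]
      refine Finset.sum_congr rfl fun x _ => ?_
      rw [Fin.card_filter_univ_succ]
      simp only [Fin.consEquiv, Equiv.coe_fn_mk, Fin.cons_zero, Fin.cons_succ]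
      congr 1
      split_ifs <;> omega
    rw [e, ← Finset.sum_filter_add_sum_filter_not Finset.univ P]
    have e1 : ∑ b with P b, ∑ s : Fin n → β, f ((if P b then 1 else 0) + #{v | P (s v)})
        = #{b | P b} * ∑ s : Fin n → β, f (#{v | P (s v)} + 1) := by
      rw [Finset.sum_congr rfl (g := fun _ => ∑ s : Fin n → β, f (#{v | P (s v)} + 1))]
      · simp
      · intro b hb
        simp [(Finset.mem_filter.1 hb).2, add_comm]
    have e2 : ∑ b with ¬ P b, ∑ s : Fin n → β, f ((if P b then 1 else 0) + #{v | P (s v)})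
        = #{b | ¬ P b} * ∑ s : Fin n → β, f (#{v | P (s v)}) := by
      rw [Finset.sum_congr rfl (g := fun _ => ∑ s : Fin n → β, f (#{v | P (s v)}))]
      · simp
      · intro b hb
        simp [(Finset.mem_filter.1 hb).2]
    have e3 : (#{b | ¬ P b} : ℝ) = Fintype.card β - #{b | P b} := by
      rw [eq_sub_iff_add_eq, ← Nat.cast_add, add_comm, Finset.card_filter_add_card_filter_not,
        Finset.card_univ]
    rw [e1, e2, e3, ih (fun N => f (N + 1)), ih f, binE]
    field_simp
    ring

/-! ### The reciprocal squared distance from the average -/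

/-- A second-order expansion of `1 / (v ^ 2 + B)` around `v = b`, where `v` is `b - u` reflected at
`0`. The remainder is a polynomial in `u`; it is crude, but harmless when `B` is large. -/
theorem div_sq_add_le {b u B : ℝ} (hb : 0 ≤ b) (hB : 0 < B) :
    (b ^ 2 + B) / ((max (b - u) 0) ^ 2 + B)
      ≤ 1 - ((max (b - u) 0) ^ 2 - b ^ 2) / (b ^ 2 + B)
        + (8 * b ^ 2 * u ^ 2 + 2 * u ^ 4) / ((b ^ 2 + B) * B) := by
  set v := max (b - u) 0 with hv
  have hv0 : 0 ≤ v := le_max_right _ _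
  have hD : 0 < b ^ 2 + B := by positivity
  have hV : 0 < v ^ 2 + B := by positivity
  have key : (v ^ 2 - b ^ 2) ^ 2 ≤ 8 * b ^ 2 * u ^ 2 + 2 * u ^ 4 := by
    have h1 : (v - b) ^ 2 ≤ u ^ 2 := by
      rcases max_cases (b - u) 0 with ⟨h, _⟩ | ⟨h, _⟩
      · rw [hv, h]; exact le_of_eq (by ring)
      · rw [hv, h]; nlinarith
    have h2 : (v + b) ^ 2 ≤ 8 * b ^ 2 + 2 * u ^ 2 := by nlinarith [sq_nonneg (2 * b - (v - b))]
    calc (v ^ 2 - b ^ 2) ^ 2 = (v - b) ^ 2 * (v + b) ^ 2 := by ring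
      _ ≤ u ^ 2 * (8 * b ^ 2 + 2 * u ^ 2) := by gcongr
      _ = _ := by ring
  have e : (b ^ 2 + B) / (v ^ 2 + B) = 1 - (v ^ 2 - b ^ 2) / (b ^ 2 + B)
      + (v ^ 2 - b ^ 2) ^ 2 / ((b ^ 2 + B) * (v ^ 2 + B)) := by
    field_simp; ring
  rw [e]
  have : (v ^ 2 - b ^ 2) ^ 2 / ((b ^ 2 + B) * (v ^ 2 + B))
      ≤ (8 * b ^ 2 * u ^ 2 + 2 * u ^ 4) / ((b ^ 2 + B) * B) := by
    gcongr
    nlinarith [sq_nonneg v]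
  linarith

/-- A lower bound for the square of the reflected distance by a polynomial in the fluctuation `m`
of degree four without cubic term. For suitable `l` and `τ`, its coefficient of `m ^ 2` extracts
the second moment of the negative part of `m`, in spite of the reflection; for `l = 0` this gain
is given up. -/
theorem max_sub_sq_ge {b η m l τ : ℝ} (hb : 0 ≤ b) (hη : 0 ≤ η) (hl : 0 ≤ l) (hτ : 0 < τ) :
    b ^ 2 - (2 * b + l) * m + l * (2 * m ^ 2 / τ - 2 * m ^ 4 / τ ^ 3) - l ^ 2
      - 2 * η * b - (10000 * η ^ 2 + m ^ 2 / 10000) ≤ (max (b - (m + η)) 0) ^ 2 := by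
  set v := max (b - (m + η)) 0 with hv
  set w := max (b - m) 0 with hw
  have hv0 : 0 ≤ v := le_max_right _ _
  have hw0 : 0 ≤ w := le_max_right _ _
  have hvw : w - η ≤ v := by
    rcases max_cases (b - m) 0 with ⟨h, _⟩ | ⟨h, _⟩
    · rw [hw, h]; linarith [le_max_left (b - (m + η)) 0]
    · rw [hw, h]; linarith
  have h1 : w ^ 2 - 2 * η * w ≤ v ^ 2 := by
    rcases le_total η w with h | h
    · nlinarith [mul_self_le_mul_self (sub_nonneg.2 h) hvw]
    · nlinarith
  have h2 : w ≤ b + |m| := by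
    refine max_le ?_ (by positivity)
    linarith [neg_abs_le m]
  -- The negative part of `m` is `(|m| - m) / 2`.
  have h3 : b ^ 2 - 2 * b * m + ((|m| - m) / 2) ^ 2 ≤ w ^ 2 := by
    rcases le_total 0 m with hm | hm
    · rw [abs_of_nonneg hm]
      rcases max_cases (b - m) 0 with ⟨h, _⟩ | ⟨h, _⟩
      · rw [hw, h]; nlinarith
      · rw [hw, h]; nlinarith
    · rw [abs_of_nonpos hm, hw, max_eq_left (by linarith)]; nlinarith
  have h4 : 2 * m ^ 2 / τ - 2 * m ^ 4 / τ ^ 3 ≤ |m| := by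
    have : 2 * m ^ 2 / τ - 2 * m ^ 4 / τ ^ 3 = τ * (2 * (|m| / τ) ^ 2 - 2 * (|m| / τ) ^ 4) := by
      rw [div_pow, div_pow, sq_abs, show |m| ^ 4 = (|m| ^ 2) ^ 2 by ring, sq_abs]
      field_simp
    rw [this]
    set t := |m| / τ
    have ht : 0 ≤ t := by positivity
    have : |m| = τ * t := by simp only [t]; field_simp
    rw [this]
    refine mul_le_mul_of_nonneg_left ?_ hτ.le
    -- The maximum of `t - t ^ 3` for `t ≥ 0` is less than `1 / 2`.
    nlinarith [mul_nonneg ht (sq_nonneg (t - 1 / 2)), mul_nonneg (mul_nonneg ht ht) (sq_nonneg (t - 1 / 2)), mul_nonneg ht (sq_nonneg (t - 3 / 5)), mul_nonneg (mul_nonneg ht ht) (sq_nonneg (t - 3 / 5))]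
  have h5 : 2 * η * |m| ≤ 10000 * η ^ 2 + m ^ 2 / 10000 := by
    rw [← sq_abs m]; nlinarith [sq_nonneg (100 * η - |m| / 100)]
  have h6 := mul_le_mul_of_nonneg_left h4 hl
  have h7 : 2 * η * w ≤ 2 * η * b + 2 * η * |m| := by nlinarith
  nlinarith [sq_nonneg ((|m| - m) / 2 - l)]

/-- The expectation of the relative change of `1 / (v ^ 2 + B)`, where `v` is the distance below
the average after a round and `b` is this distance without fluctuation and error `η`. The numbers
`l` and `τ` are free, see `max_sub_sq_ge`. -/
theorem binE_div_sq_add_le {q : ℝ} (h0 : 0 ≤ q) (h1 : q ≤ 1) (n : ℕ) {b η B l τ : ℝ}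
    (hb : 0 ≤ b) (hη : 0 ≤ η) (hl : 0 ≤ l) (hτ : 0 < τ) (hB : 0 < B) :
    binE q n (fun N => (b ^ 2 + B) / ((max (b - ((N : ℝ) - n * q + η)) 0) ^ 2 + B))
      ≤ 1 + (l ^ 2 + 2 * η * b + 10000 * η ^ 2 + 16 * (b ^ 2 * η ^ 2 + η ^ 4) / B
        + (-(2 * l / τ) + 1 / 10000 + 16 * b ^ 2 / B) * (n * q * (1 - q))
        + (2 * l / τ ^ 3 + 16 / B) * (3 * (n * q * (1 - q)) ^ 2 + n * q * (1 - q)))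
          / (b ^ 2 + B) := by
  have hD : 0 < b ^ 2 + B := by positivity
  set D := b ^ 2 + B with hDdef
  have e := binE_mono h0 h1 n
    (f := fun N => D / ((max (b - ((N : ℝ) - n * q + η)) 0) ^ 2 + B))
    (g := fun N => (1 + (l ^ 2 + 2 * η * b + 10000 * η ^ 2 + 16 * (b ^ 2 * η ^ 2 + η ^ 4) / B) / D)
      + ((2 * b + l) / D) * ((N : ℝ) - n * q)
      + ((-(2 * l / τ) + 1 / 10000 + 16 * b ^ 2 / B) / D) * ((N : ℝ) - n * q) ^ 2
      + ((2 * l / τ ^ 3 + 16 / B) / D) * ((N : ℝ) - n * q) ^ 4) ?_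
  · refine e.trans ((binE_centred_poly_le h0 h1 n _ _ _ _ (by positivity)).trans (le_of_eq ?_))
    ring
  · intro N
    set m := (N : ℝ) - n * q
    have a1 := div_sq_add_le (u := m + η) hb hB
    have a2 := max_sub_sq_ge (m := m) hb hη hl hτ
    have a3 : 8 * b ^ 2 * (m + η) ^ 2 + 2 * (m + η) ^ 4
        ≤ 16 * (b ^ 2 * η ^ 2 + η ^ 4) + 16 * b ^ 2 * m ^ 2 + 16 * m ^ 4 := by
      have b1 : (m + η) ^ 2 ≤ 2 * m ^ 2 + 2 * η ^ 2 := by nlinarith [sq_nonneg (m - η)]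
      have b2 : (m + η) ^ 4 ≤ 8 * m ^ 4 + 8 * η ^ 4 := by
        nlinarith [sq_nonneg (m ^ 2 - η ^ 2), mul_self_le_mul_self (sq_nonneg (m + η)) b1]
      nlinarith [mul_le_mul_of_nonneg_left b1 (sq_nonneg b)]
    refine a1.trans ?_
    set v := (max (b - (m + η)) 0) ^ 2
    have a4 : (8 * b ^ 2 * (m + η) ^ 2 + 2 * (m + η) ^ 4) / (D * B)
        ≤ (16 * (b ^ 2 * η ^ 2 + η ^ 4) + 16 * b ^ 2 * m ^ 2 + 16 * m ^ 4) / (D * B) := by gcongr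
    have a5 : (b ^ 2 - (2 * b + l) * m + l * (2 * m ^ 2 / τ - 2 * m ^ 4 / τ ^ 3) - l ^ 2
      - 2 * η * b - (10000 * η ^ 2 + m ^ 2 / 10000) - b ^ 2) / D ≤ (v - b ^ 2) / D := by gcongr
    have a6 : 1 - (b ^ 2 - (2 * b + l) * m + l * (2 * m ^ 2 / τ - 2 * m ^ 4 / τ ^ 3) - l ^ 2
        - 2 * η * b - (10000 * η ^ 2 + m ^ 2 / 10000) - b ^ 2) / D
        + (16 * (b ^ 2 * η ^ 2 + η ^ 4) + 16 * b ^ 2 * m ^ 2 + 16 * m ^ 4) / (D * B)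
        = 1 + (l ^ 2 + 2 * η * b + 10000 * η ^ 2 + 16 * (b ^ 2 * η ^ 2 + η ^ 4) / B) / D
      + (2 * b + l) / D * m + (-(2 * l / τ) + 1 / 10000 + 16 * b ^ 2 / B) / D * m ^ 2
      + (2 * l / τ ^ 3 + 16 / B) / D * m ^ 4 := by
      field_simp; ring
    linarith

/-! ### Ratio estimates for the two ranges of the size -/

set_option maxHeartbeats 1000000 in
/-- Close to the average, the reciprocal of `y ^ 2 + 10⁶ n` shrinks in expectation by a factor
`1 - Ω(r)`. Here `r n` is the size of the smallest competitor, `y` its distance below the average,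
`V` the variance of its next size, and `E` the expectation bounded in `binE_div_sq_add_le`, taken
relative to the deterministic next distance `y (1 + r)`. -/
theorem near_ratio_le {n r y η V : ℝ} (hn : 1 ≤ n) (hr : 0 < r) (hr2 : r ≤ 1 / 2)
    (hX : 1 ≤ r * n) (hy : 0 ≤ y) (hη : 0 ≤ η) (hη2 : η ^ 2 ≤ (r / 10 ^ 11) ^ 2 * n)
    (hV : 3 / 10 * (r * n) ≤ V) (hV2 : V ≤ 11 / 10 * (r * n)) {E : ℝ}
    (hE : ∀ l τ : ℝ, 0 ≤ l → 0 < τ → E ≤ 1 + (l ^ 2 + 2 * η * (y * (1 + r)) + 10000 * η ^ 2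
        + 16 * ((y * (1 + r)) ^ 2 * η ^ 2 + η ^ 4) / (10 ^ 6 * n)
        + (-(2 * l / τ) + 1 / 10000 + 16 * (y * (1 + r)) ^ 2 / (10 ^ 6 * n)) * V
        + (2 * l / τ ^ 3 + 16 / (10 ^ 6 * n)) * (3 * V ^ 2 + V))
          / ((y * (1 + r)) ^ 2 + 10 ^ 6 * n)) :
    (y ^ 2 + 10 ^ 6 * n) / ((y * (1 + r)) ^ 2 + 10 ^ 6 * n) * E ≤ 1 - 8 / 10 ^ 11 * r := by
  have hn0 : 0 < n := by linarith
  set X := r * n with hXdef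
  have hX0 : 0 < X := by linarith
  have hV0 : 0 < V := by linarith
  set b := y * (1 + r) with hb
  have hb2 : b ^ 2 ≤ 9 / 4 * y ^ 2 := by
    have : (1 + r) ^ 2 ≤ 9 / 4 := by nlinarith
    rw [hb, mul_pow]; nlinarith [sq_nonneg y]
  have hb3 : y ^ 2 + 2 * r * y ^ 2 ≤ b ^ 2 := by
    rw [hb]; nlinarith [mul_nonneg (sq_nonneg r) (sq_nonneg y)]
  set B := (10 : ℝ) ^ 6 * n with hB
  have hB0 : 0 < B := by positivity
  have hηX : η ^ 2 ≤ X / 10 ^ 22 := by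
    have : (r / 10 ^ 11) ^ 2 * n = r * X / 10 ^ 22 := by rw [hXdef]; ring
    rw [this] at hη2
    have : r * X ≤ 1 * X := by gcongr; linarith
    calc η ^ 2 ≤ r * X / 10 ^ 22 := hη2
      _ ≤ X / 10 ^ 22 := by gcongr; linarith
  set s := Real.sqrt X with hs
  have hs0 : 0 < s := Real.sqrt_pos.2 hX0
  have hs2 : s ^ 2 = X := Real.sq_sqrt hX0.le
  -- With these `l` and `τ`, of the order of the standard deviation, the gain in the coefficient
  -- of `V` outweighs all other terms of order `X`.
  have h := hE (s / 40) (6 * s) (by positivity) (by positivity)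
  have t1 : (s / 40) ^ 2 = X / 1600 := by rw [div_pow, hs2]; norm_num
  have t2 : 2 * (s / 40) / (6 * s) = 1 / 120 := by field_simp; norm_num
  have t3 : 2 * (s / 40) / (6 * s) ^ 3 = 1 / (4320 * X) := by
    rw [← hs2]; field_simp; norm_num
  rw [t1, t2, t3] at h
  have u1 : 2 * η * b ≤ r * y ^ 2 / 20 + X / 10 ^ 10 := by
    have : b ≤ 3 / 2 * y := by rw [hb]; nlinarith
    have w1 : 2 * η * b ≤ 3 * η * y := by nlinarith
    have w2 : 3 * η * y ≤ r * y ^ 2 / 20 + 45 * η ^ 2 / r := by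
      have : r * y ^ 2 / 20 + 45 * η ^ 2 / r - 3 * η * y = (r * y - 30 * η) ^ 2 / (20 * r) := by
        field_simp; ring
      have : 0 ≤ (r * y - 30 * η) ^ 2 / (20 * r) := by positivity
      linarith
    have w3 : 45 * η ^ 2 / r ≤ X / 10 ^ 10 := by
      rw [div_le_iff₀ hr]
      have : (r / 10 ^ 11) ^ 2 * n = r * X / 10 ^ 22 := by rw [hXdef]; ring
      rw [this] at hη2
      nlinarith [mul_pos hr hX0]
    linarith
  have u2 : 16 * (b ^ 2 * η ^ 2 + η ^ 4) / B ≤ r * y ^ 2 / 1000 + X / 10 ^ 6 := by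
    have w1 : b ^ 2 * η ^ 2 ≤ 9 / 4 * y ^ 2 * (X / 10 ^ 22) := by gcongr
    have w2 : η ^ 4 ≤ X / 10 ^ 22 * (X / 10 ^ 22) := by
      calc η ^ 4 = η ^ 2 * η ^ 2 := by ring
        _ ≤ _ := by gcongr
    rw [div_le_iff₀ hB0]
    have w3 : X ≤ n := by rw [hXdef]; nlinarith
    have w4 : r * y ^ 2 * n = X * y ^ 2 := by rw [hXdef]; ring
    have w5 : X * X ≤ X * n := by gcongr
    rw [hB]
    nlinarith [mul_nonneg hX0.le (sq_nonneg y), mul_pos hX0 hn0]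
  have u3 : 16 * b ^ 2 / B * V ≤ r * y ^ 2 / 1000 := by
    rw [div_mul_eq_mul_div, div_le_iff₀ hB0]
    have w4 : r * y ^ 2 * n = X * y ^ 2 := by rw [hXdef]; ring
    have w1 : b ^ 2 * V ≤ 9 / 4 * y ^ 2 * (11 / 10 * X) := by gcongr
    rw [hB]
    nlinarith [mul_nonneg hX0.le (sq_nonneg y)]
  have u4 : (1 / (4320 * X) + 16 / B) * (3 * V ^ 2 + V) ≤ V / 900 := by
    have w1 : 3 * V ^ 2 + V ≤ 43 / 10 * X * V := by nlinarith
    have w2 : 16 / B ≤ 1 / (50000 * X) := by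
      rw [div_le_div_iff₀ hB0 (by positivity), hB]
      have : X ≤ n := by rw [hXdef]; nlinarith
      linarith
    calc (1 / (4320 * X) + 16 / B) * (3 * V ^ 2 + V)
        ≤ (1 / (4320 * X) + 1 / (50000 * X)) * (43 / 10 * X * V) := by gcongr
      _ = (1 / 4320 + 1 / 50000) * (43 / 10) * V := by field_simp
      _ ≤ V / 900 := by linarith
  set D := b ^ 2 + B with hD
  have hD0 : 0 < D := by positivity
  have hR : E ≤ 1 + (-(X / 1000) + r * y ^ 2 / 10) / D := by
    refine h.trans (add_le_add_right (div_le_div_of_nonneg_right ?_ hD0.le) 1)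
    have v1 := mul_nonneg hr.le (sq_nonneg y)
    linarith only [hηX, v1, u1, u2, u3, u4, hV, hX0]
  have hDD : D ≤ 9 / 4 * (y ^ 2 + B) := by rw [hD]; linarith
  calc (y ^ 2 + B) / D * E ≤ (y ^ 2 + B) / D * (1 + (-(X / 1000) + r * y ^ 2 / 10) / D) := by gcongr
    _ ≤ 1 - 8 / 10 ^ 11 * r := by
      set p := (y ^ 2 + B) / D with hp
      have hp1 : p ≤ 1 := by
        rw [hp, div_le_one hD0, hD]; nlinarith [mul_nonneg hr.le (sq_nonneg y)]
      have hp2 : 4 / 9 ≤ p := by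
        rw [hp, le_div_iff₀ hD0]; linarith
      have hp3 : p * D = y ^ 2 + B := by rw [hp]; field_simp
      have : p * (1 + (-(X / 1000) + r * y ^ 2 / 10) / D)
          = (p * D + p * (-(X / 1000) + r * y ^ 2 / 10)) / D := by field_simp
      rw [this, div_le_iff₀ hD0, hp3]
      have v1 : p * (-(X / 1000) + r * y ^ 2 / 10) ≤ -(X / 2250) + r * y ^ 2 / 10 := by
        nlinarith [mul_nonneg hr.le (sq_nonneg y)]
      have v2 : 8 / 10 ^ 11 * r * D ≤ 8 / 10 ^ 11 * r * (9 / 4 * (y ^ 2 + B)) := by gcongr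
      have v3 : r * B = 10 ^ 6 * X := by rw [hB, hXdef]; ring
      have v4 := mul_nonneg hr.le (sq_nonneg y)
      have v5 : D = b ^ 2 + B := hD
      linarith only [v1, v2, v3, v4, v5, hb3, hX0, hr]

set_option maxHeartbeats 1000000 in
/-- Far below the average, the fluctuations do little harm: the reciprocal of `y ^ 2 + 10⁶ n` grows
in expectation by a factor of at most `1 + J / 100`, where `J` is the inverse of the number of
competitors. The notation is that of `near_ratio_le`. -/
theorem far_ratio_le {n r y η V J : ℝ} (hn : 1 ≤ n) (hr : 0 < r) (hJ : J ≤ 1 / 2)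
    (hrJ : r ≤ J) (hX : 1 ≤ r * n) (hy : J * n / 4 ≤ y) (hη : 0 ≤ η)
    (hη1 : η ≤ r * n * J / 10 ^ 12) (hη2 : η ^ 2 ≤ (J / 10 ^ 12) ^ 2 * n)
    (hV : 0 ≤ V) (hV2 : V ≤ 11 / 10 * (r * n)) {E : ℝ}
    (hE : ∀ l τ : ℝ, 0 ≤ l → 0 < τ → E ≤ 1 + (l ^ 2 + 2 * η * (y * (1 + r)) + 10000 * η ^ 2
        + 16 * ((y * (1 + r)) ^ 2 * η ^ 2 + η ^ 4) / (10 ^ 6 * n)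
        + (-(2 * l / τ) + 1 / 10000 + 16 * (y * (1 + r)) ^ 2 / (10 ^ 6 * n)) * V
        + (2 * l / τ ^ 3 + 16 / (10 ^ 6 * n)) * (3 * V ^ 2 + V))
          / ((y * (1 + r)) ^ 2 + 10 ^ 6 * n)) :
    (y ^ 2 + 10 ^ 6 * n) / ((y * (1 + r)) ^ 2 + 10 ^ 6 * n) * E ≤ 1 + J / 100 := by
  have hn0 : 0 < n := by linarith
  have hJ0 : 0 < J := hr.trans_le hrJ
  have hy0 : 0 < y := lt_of_lt_of_le (by positivity) hy
  set X := r * n with hXdef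
  have hX0 : 0 < X := by linarith
  have hXJ : X ≤ J * n := by rw [hXdef]; gcongr
  set b := y * (1 + r) with hb
  have hb2 : b ^ 2 ≤ 9 / 4 * y ^ 2 := by
    have : (1 + r) ^ 2 ≤ 9 / 4 := by nlinarith
    rw [hb, mul_pow]; nlinarith [sq_nonneg y]
  have hb3 : y ^ 2 + 2 * r * y ^ 2 ≤ b ^ 2 := by
    rw [hb]; nlinarith [mul_nonneg (sq_nonneg r) (sq_nonneg y)]
  set B := (10 : ℝ) ^ 6 * n with hB
  have hB0 : 0 < B := by positivity
  have h := hE 0 1 le_rfl one_pos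
  have hJn : 0 < J * n := by positivity
  have hηJ : η ^ 2 ≤ J * n / 10 ^ 24 := by
    refine hη2.trans ?_
    have : J * (J * n) ≤ 1 * (J * n) := by gcongr; linarith
    rw [one_mul] at this
    calc (J / 10 ^ 12) ^ 2 * n = J * (J * n) / 10 ^ 24 := by ring
      _ ≤ J * n / 10 ^ 24 := by gcongr
  have u1 : 2 * η * b ≤ r * y ^ 2 / 2 := by
    have : b ≤ 3 / 2 * y := by rw [hb]; nlinarith
    have w1 : 2 * η * b ≤ 3 * η * y := by nlinarith
    have w2 : η ≤ r * y / 10 ^ 11 := by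
      refine hη1.trans ?_
      have : r * (J * n / 4) ≤ r * y := by gcongr
      have e : X * J = 4 * (r * (J * n / 4)) := by rw [hXdef]; ring
      rw [e]
      nlinarith [mul_pos hr hy0]
    nlinarith [mul_pos hr hy0, mul_pos (mul_pos hr hy0) hy0]
  have u2 : 16 * (b ^ 2 * η ^ 2 + η ^ 4) / B ≤ J * y ^ 2 / 1000 + J * n := by
    have w1 : b ^ 2 * η ^ 2 ≤ 9 / 4 * y ^ 2 * (J * n / 10 ^ 24) := by gcongr
    have w2 : η ^ 4 ≤ J * n / 10 ^ 24 * (J * n / 10 ^ 24) := by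
      calc η ^ 4 = η ^ 2 * η ^ 2 := by ring
        _ ≤ _ := by gcongr
    rw [div_le_iff₀ hB0]
    have w3 : J * n ≤ n := by nlinarith
    have w5 : J * n * (J * n) ≤ J * n * n := by gcongr
    have w6 : 0 ≤ J * n * y ^ 2 := by positivity
    have w7 : 0 ≤ J * n * n := by positivity
    rw [hB]
    nlinarith
  have u3 : 16 * b ^ 2 / B * V ≤ r * y ^ 2 / 1000 := by
    rw [div_mul_eq_mul_div, div_le_iff₀ hB0]
    have w4 : r * y ^ 2 * n = X * y ^ 2 := by rw [hXdef]; ring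
    have w1 : b ^ 2 * V ≤ 9 / 4 * y ^ 2 * (11 / 10 * X) := by gcongr
    rw [hB]
    nlinarith [mul_nonneg hX0.le (sq_nonneg y)]
  have u4 : 16 / B * (3 * V ^ 2 + V) ≤ J * n := by
    have w1 : 3 * V ^ 2 + V ≤ 5 * X * X := by nlinarith
    rw [div_mul_eq_mul_div, div_le_iff₀ hB0, hB]
    have w2 : X * X ≤ J * n * (J * n) := by gcongr
    have w5 : J * n * (J * n) ≤ J * n * n := by gcongr; nlinarith
    have w7 : 0 ≤ J * n * n := by positivity
    nlinarith
  set D := b ^ 2 + B with hD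
  have hD0 : 0 < D := by positivity
  have hR : E ≤ 1 + (r * y ^ 2 + J / 100 * D) / D := by
    refine h.trans (add_le_add_right (div_le_div_of_nonneg_right ?_ hD0.le) 1)
    have v1 : J * y ^ 2 + 10 ^ 6 * (J * n) ≤ J * D := by
      rw [hD, hB]; nlinarith [mul_nonneg hr.le (sq_nonneg y)]
    have v2 := mul_nonneg hr.le (sq_nonneg y)
    have v3 := mul_nonneg hJ0.le (sq_nonneg y)
    linarith only [u1, u2, u3, u4, v1, v2, v3, hηJ, hV2, hXJ, hJn, hV]
  calc (y ^ 2 + B) / D * E ≤ (y ^ 2 + B) / D * (1 + (r * y ^ 2 + J / 100 * D) / D) := by gcongr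
    _ ≤ 1 + J / 100 := by
      set p := (y ^ 2 + B) / D with hp
      have hp1 : p ≤ 1 := by
        rw [hp, div_le_one hD0, hD]; nlinarith [mul_nonneg hr.le (sq_nonneg y)]
      have hp3 : p * D = y ^ 2 + B := by rw [hp]; field_simp
      have : p * (1 + (r * y ^ 2 + J / 100 * D) / D)
          = (p * D + p * (r * y ^ 2 + J / 100 * D)) / D := by field_simp
      rw [this, div_le_iff₀ hD0, hp3]
      have v1 : p * (r * y ^ 2 + J / 100 * D) ≤ 1 * (r * y ^ 2 + J / 100 * D) := by gcongr
      have v4 := mul_nonneg hr.le (sq_nonneg y)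
      have v5 : D = b ^ 2 + B := hD
      linarith only [v1, v4, v5, hb3]

/-! ### The potential of the smallest competitor -/

/-- The potential of the size `X` of the smallest of several opinions, when their average size is
at most `μ`. The first factor decreases while `X` is close to `μ`, the second one once `X` is
well below `μ`. -/
def sizePotential (a μ X : ℝ) : ℝ := Real.sqrt (a / ((μ - X) ^ 2 + a) * (1 + X))

theorem sizePotential_mono {a μ X Y : ℝ} (ha : 0 < a) (hX : 0 ≤ X) (hXY : X ≤ Y) (hY : Y ≤ μ) :
    sizePotential a μ X ≤ sizePotential a μ Y := by
  unfold sizePotential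
  apply Real.sqrt_le_sqrt
  have h1 : (μ - Y) ^ 2 ≤ (μ - X) ^ 2 := by
    apply pow_le_pow_left₀ <;> linarith
  have : 0 ≤ 1 + X := by linarith
  gcongr

/-- The inequality of the arithmetic and the geometric mean separates the two factors of the
potential, so that only the expectation of each of them is needed. -/
theorem sizePotential_ratio_le {a μ X z : ℝ} (ha : 0 < a) (hX : 0 ≤ X) (hz : 0 ≤ z) :
    sizePotential a μ z ≤ sizePotential a μ X
      * ((((μ - X) ^ 2 + a) / ((μ - z) ^ 2 + a) + (1 + z) / (1 + X)) / 2) := by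
  have h1 : 0 < (μ - X) ^ 2 + a := by positivity
  have h2 : 0 < (μ - z) ^ 2 + a := by positivity
  have h3 : 0 < 1 + X := by linarith
  have h4 : 0 ≤ 1 + z := by linarith
  unfold sizePotential
  refine Real.sqrt_le_iff.2 ⟨by positivity, ?_⟩
  rw [mul_pow, Real.sq_sqrt (by positivity)]
  set p := ((μ - X) ^ 2 + a) / ((μ - z) ^ 2 + a) with hp
  set r := (1 + z) / (1 + X) with hr
  have e : a / ((μ - z) ^ 2 + a) * (1 + z) = a / ((μ - X) ^ 2 + a) * (1 + X) * (p * r) := by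
    rw [hp, hr]; field_simp
  rw [e]
  apply mul_le_mul_of_nonneg_left _ (by positivity)
  nlinarith [sq_nonneg (p - r)]

set_option maxHeartbeats 1000000 in
/-- The drift of the potential of the smallest of `j` opinions, of size `X`: the next size is at
most binomial plus the number `f` of nodes the adversary controls, and at most the average.
The error `η` collects the influence of the adversary and of the remaining opinions. -/
theorem binE_sizePotential_le {n f : ℕ} {j X q η : ℝ} (hn : 1 ≤ n) (hj : 2 ≤ j) (hX : 1 ≤ X)
    (hXj : X ≤ n / j) (hf : f ≤ η) (hq : n * q = X * (1 - (n / j - X) / n) + (η - f))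
    (hη1 : η ≤ X / j / 10 ^ 12) (hη2 : η ≤ Real.sqrt n / j / 10 ^ 12) :
    binE q n (fun N => sizePotential (10 ^ 6 * n) (n / j) (min (N + f) (n / j)))
      ≤ (1 - 1 / 10 ^ 11 / j) * sizePotential (10 ^ 6 * n) (n / j) X := by
  have hn1 : (1 : ℝ) ≤ n := by exact_mod_cast hn
  have hn0 : (0 : ℝ) < n := by linarith
  have hj0 : 0 < j := by linarith
  have hX0 : 0 < X := by linarith
  have hf0 : (0 : ℝ) ≤ f := Nat.cast_nonneg f
  have hη0 : 0 ≤ η := hf0.trans hf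
  obtain ⟨J, hJ⟩ : ∃ J, J = 1 / j := ⟨_, rfl⟩
  have hJ0 : 0 < J := by rw [hJ]; positivity
  have hJ2 : J ≤ 1 / 2 := by rw [hJ]; exact one_div_le_one_div_of_le two_pos hj
  have eμ : (n : ℝ) / j = J * n := by rw [hJ]; ring
  have e1 : X / j = X * J := by rw [hJ]; ring
  have e2 : Real.sqrt n / j = Real.sqrt n * J := by rw [hJ]; ring
  have e3 : (1 : ℝ) / 10 ^ 11 / j = 1 / 10 ^ 11 * J := by rw [hJ]; ring
  rw [e3]
  rw [eμ] at hXj hq ⊢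
  rw [e1] at hη1
  rw [e2] at hη2
  obtain ⟨r, hr⟩ : ∃ r, r = X / n := ⟨_, rfl⟩
  have hXr : X = r * n := by rw [hr]; field_simp
  have hr0 : 0 < r := by rw [hr]; positivity
  have hrJ : r ≤ J := by rw [hr, div_le_iff₀ hn0]; exact hXj
  obtain ⟨y, hy⟩ : ∃ y, y = J * n - X := ⟨_, rfl⟩
  have hy0 : 0 ≤ y := by linarith
  have hyn : y / n = J - r := by rw [hy, hr]; field_simp
  rw [← hy, hyn] at hq
  have hηX : η ≤ X / 10 ^ 12 := by
    have : X * J ≤ X * 1 := by gcongr; linarith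
    linarith
  have hq0 : 0 ≤ q := by
    have : 0 ≤ (n : ℝ) * q := by
      rw [hq]
      exact add_nonneg (mul_nonneg hX0.le (by linarith)) (by linarith)
    exact nonneg_of_mul_nonneg_right this hn0
  have hq55 : q ≤ 11 / 20 := by
    have : (n : ℝ) * q ≤ n * (11 / 20) := by
      rw [hq]
      have : X * (1 - (J - r)) ≤ X * 1 := by gcongr; linarith
      have : X ≤ 1 / 2 * n := by rw [hXr]; gcongr; linarith
      linarith
    exact le_of_mul_le_mul_left this hn0
  have hq1 : q ≤ 1 := by linarith
  set V := (n : ℝ) * q * (1 - q) with hV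
  have hnq : (n : ℝ) * q ≤ 11 / 10 * X := by
    rw [hq]
    have : X * (1 - (J - r)) ≤ X * 1 := by gcongr; linarith
    linarith
  have hnq0 : 0 ≤ (n : ℝ) * q := by positivity
  have hV0 : 0 ≤ V := mul_nonneg hnq0 (by linarith)
  have hV2 : V ≤ 11 / 10 * (r * n) := by
    rw [← hXr, hV]
    exact (mul_le_of_le_one_right hnq0 (by linarith)).trans hnq
  set a := (10 : ℝ) ^ 6 * n with ha
  have ha0 : 0 < a := by positivity
  set b := y * (1 + r) with hb
  have hb0 : 0 ≤ b := by positivity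
  set g : ℕ → ℝ := fun N => (b ^ 2 + a) / ((max (b - ((N : ℝ) - n * q + η)) 0) ^ 2 + a) with hg
  have hE : ∀ l τ : ℝ, 0 ≤ l → 0 < τ → _ := fun l τ hl hτ =>
    binE_div_sq_add_le hq0 hq1 n hb0 hη0 hl hτ ha0
  have hfirst : ∀ N : ℕ, (y ^ 2 + a) / ((J * n - min ((N : ℝ) + f) (J * n)) ^ 2 + a)
      = (y ^ 2 + a) / (b ^ 2 + a) * g N := by
    intro N
    have : J * n - min ((N : ℝ) + f) (J * n) = max (b - ((N : ℝ) - n * q + η)) 0 := by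
      have h : b - ((N : ℝ) - n * q + η) = J * n - (N + f) := by
        rw [hq, hb, hXr, hy, hXr]; ring
      rw [h, ← max_sub_sub_left, sub_self]
    rw [this, hg]
    have : b ^ 2 + a ≠ 0 := by positivity
    field_simp
  have hlin : binE q n (fun N => (1 + ((N : ℝ) + f)) / (1 + X)) = 1 - (r * y - η) / (1 + X) := by
    have : (fun N : ℕ => (1 + ((N : ℝ) + f)) / (1 + X))
        = fun N : ℕ => (1 / (1 + X)) * ((N : ℝ) + (1 + f)) := by
      ext N; ring
    rw [this, binE_const_mul, binE_shift_one, hq]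
    have : 1 + X ≠ 0 := by positivity
    field_simp
    rw [hy, hXr]; ring
  have hpt : ∀ N : ℕ, sizePotential a (J * n) (min ((N : ℝ) + f) (J * n))
      ≤ (sizePotential a (J * n) X / 2) * ((y ^ 2 + a) / (b ^ 2 + a) * g N)
        + (sizePotential a (J * n) X / 2) * ((1 + ((N : ℝ) + f)) / (1 + X)) := by
    intro N
    have hz : 0 ≤ min ((N : ℝ) + f) (J * n) := le_min (by positivity) (by positivity)
    refine (sizePotential_ratio_le ha0 hX0.le hz).trans ?_
    rw [← hfirst N, ← hy, ← mul_add, div_mul_eq_mul_div, ← mul_div_assoc]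
    have h0 : 0 ≤ sizePotential a (J * n) X := Real.sqrt_nonneg _
    have : (1 + min ((N : ℝ) + f) (J * n)) / (1 + X) ≤ (1 + ((N : ℝ) + f)) / (1 + X) := by
      gcongr; exact min_le_left _ _
    gcongr
  refine (binE_mono hq0 hq1 n hpt).trans ?_
  rw [binE_add, binE_const_mul, binE_const_mul, binE_const_mul, hlin]
  have hS : 0 ≤ sizePotential a (J * n) X := Real.sqrt_nonneg _
  suffices h : (y ^ 2 + a) / (b ^ 2 + a) * binE q n g + (1 - (r * y - η) / (1 + X))
      ≤ 2 * (1 - 1 / 10 ^ 11 * J) by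
    rw [← mul_add]
    refine (mul_le_mul_of_nonneg_left h (by positivity)).trans (le_of_eq ?_)
    ring
  have hsn : Real.sqrt n ^ 2 = n := Real.sq_sqrt hn0.le
  have hη3 : η ^ 2 ≤ (J / 10 ^ 12) ^ 2 * n := by
    calc η ^ 2 ≤ (Real.sqrt n * J / 10 ^ 12) ^ 2 := by gcongr
      _ = (J / 10 ^ 12) ^ 2 * Real.sqrt n ^ 2 := by ring
      _ = _ := by rw [hsn]
  rcases le_total (J * n / 4) y with hcase | hcase
  · have h1 := far_ratio_le hn1 hr0 hJ2 hrJ (hXr ▸ hX) hcase hη0 (hXr ▸ hη1) hη3 hV0 hV2 hE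
    have h2 : J / 10 ≤ (r * y - η) / (1 + X) := by
      rw [le_div_iff₀ (by positivity)]
      have : X * J / 4 ≤ r * y := by
        calc X * J / 4 = r * (J * n / 4) := by rw [hXr]; ring
          _ ≤ r * y := by gcongr
      have : 1 * J ≤ X * J := by gcongr
      linarith only [this, hη1, ‹X * J / 4 ≤ r * y›, hJ0]
    have h1' : (y ^ 2 + a) / (b ^ 2 + a) * binE q n g ≤ 1 + J / 100 := h1
    linarith
  · have hX34 : 3 / 4 * (J * n) ≤ X := by linarith
    have hrJ34 : 3 / 4 * J ≤ r := by rw [hr, le_div_iff₀ hn0]; linarith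
    have hη4 : η ^ 2 ≤ (r / 10 ^ 11) ^ 2 * n := by
      refine hη3.trans ?_
      gcongr ?_ ^ 2 * _
      linarith
    have hV1 : 3 / 10 * (r * n) ≤ V := by
      rw [← hXr, hV]
      have h1 : 7 / 8 * X ≤ n * q := by
        rw [hq]
        have : X * (7 / 8) ≤ X * (1 - (J - r)) := by gcongr; linarith
        linarith
      calc 3 / 10 * X ≤ 7 / 8 * X * (9 / 20) := by linarith
        _ ≤ n * q * (1 - q) := by gcongr; linarith
    have h1 := near_ratio_le hn1 hr0 (hrJ.trans hJ2) (hXr ▸ hX) hy0 hη0 hη4 hV1 hV2 hE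
    have h1' : (y ^ 2 + a) / (b ^ 2 + a) * binE q n g ≤ 1 - 8 / 10 ^ 11 * r := h1
    have h2 : -(J / 10 ^ 12) ≤ (r * y - η) / (1 + X) := by
      rw [le_div_iff₀ (by positivity)]
      have : X * J = J * X := mul_comm _ _
      linarith only [mul_nonneg hr0.le hy0, hη1, this, hJ0]
    linarith

/-! ### One round of the dynamics -/

open Classical in
/-- The probability that one node adopts an opinion with the property `p` in the next round. -/
def adoptProb {n : ℕ} {S : Type*} (x : Config n S) (p : S → Prop) : ℝ :=
  (#{b : Fin 3 → Fin n | p (majority3 (x (b 0)) (x (b 1)) (x (b 2)))} : ℝ)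
    / Fintype.card (Fin 3 → Fin n)

theorem adoptProb_nonneg {n : ℕ} {S : Type*} (x : Config n S) (p : S → Prop) :
    0 ≤ adoptProb x p := by
  unfold adoptProb; positivity

open Classical in
/-- A node adopts an opinion with the property `p` if its last two samples agree on one, or if its
first sample has one and the last two differ. -/
theorem adoptProb_le {n : ℕ} [NeZero n] {S : Type*} (x : Config n S) (p : S → Prop) :
    n * adoptProb x p ≤ #{v | p (x v)}
      * (1 + #{v | p (x v)} / n - #{t : Fin n × Fin n | x t.1 = x t.2} / (n : ℝ) ^ 2) := by
  have hn : (0 : ℝ) < n := by exact_mod_cast Nat.pos_of_ne_zero (NeZero.ne n)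
  set Y := #{v | p (x v)} with hY
  set P := #{t : Fin n × Fin n | x t.1 = x t.2} with hP
  have h1 : #{b : Fin 3 → Fin n | p (majority3 (x (b 0)) (x (b 1)) (x (b 2)))}
      ≤ n * (Y * Y) + Y * #{t : Fin n × Fin n | ¬ x t.1 = x t.2} := by
    have hinj : Function.Injective fun b : Fin 3 → Fin n => (b 0, b 1, b 2) := by
      intro b c h
      simp only [Prod.mk.injEq] at h
      ext i
      fin_cases i
      · exact congrArg _ h.1
      · exact congrArg _ h.2.1
      · exact congrArg _ h.2.2
    rw [← Finset.card_image_of_injective _ hinj]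
    have hsub : Finset.image (fun b : Fin 3 → Fin n => (b 0, b 1, b 2))
        {b : Fin 3 → Fin n | p (majority3 (x (b 0)) (x (b 1)) (x (b 2)))}
        ⊆ (Finset.univ ×ˢ (({v | p (x v)} : Finset (Fin n)) ×ˢ ({v | p (x v)} : Finset (Fin n))))
          ∪ (({v | p (x v)} : Finset (Fin n))
              ×ˢ ({t : Fin n × Fin n | ¬ x t.1 = x t.2} : Finset (Fin n × Fin n))) := by
      intro t ht
      obtain ⟨b, hb, rfl⟩ := Finset.mem_image.1 ht
      have hb := (Finset.mem_filter.1 hb).2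
      unfold majority3 at hb
      split_ifs at hb with h
      · have hc := hb
        rw [h] at hc
        simp [hb, hc]
      · simp [hb, h]
    refine (Finset.card_le_card hsub).trans ((Finset.card_union_le _ _).trans ?_)
    simp only [Finset.card_product, Finset.card_univ, Fintype.card_fin]
    exact le_rfl
  have h2 : (#{t : Fin n × Fin n | ¬ x t.1 = x t.2} : ℝ) = (n : ℝ) ^ 2 - P := by
    rw [eq_sub_iff_add_eq, hP, add_comm]
    have := Finset.card_filter_add_card_filter_not (s := (Finset.univ : Finset (Fin n × Fin n)))
      (fun t => x t.1 = x t.2)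
    rw [Finset.card_univ, Fintype.card_prod, Fintype.card_fin] at this
    rw [sq]
    exact_mod_cast this
  have h3 : (#{b : Fin 3 → Fin n | p (majority3 (x (b 0)) (x (b 1)) (x (b 2)))} : ℝ)
      ≤ n * (Y * Y) + Y * ((n : ℝ) ^ 2 - P) := by
    rw [← h2]; exact_mod_cast h1
  have h4 : (Fintype.card (Fin 3 → Fin n) : ℝ) = (n : ℝ) ^ 3 := by simp
  unfold adoptProb
  rw [h4]
  calc (n : ℝ) * (#{b : Fin 3 → Fin n | p (majority3 (x (b 0)) (x (b 1)) (x (b 2)))} / (n : ℝ) ^ 3)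
      ≤ n * ((n * (Y * Y) + Y * ((n : ℝ) ^ 2 - P)) / (n : ℝ) ^ 3) := by gcongr
    _ = _ := by field_simp; ring

open Classical in
/-- The number of nodes whose opinion is not in `A`. -/
def outSize {n : ℕ} {S : Type*} (A : Finset S) (x : Config n S) : ℕ := #{v : Fin n | x v ∉ A}

open Classical in
theorem outSize_eq {n : ℕ} {S : Type*} (A : Finset S) (x : Config n S) :
    outSize A x = #{v : Fin n | x v ∉ A} := rfl

theorem outSize_le {n : ℕ} {S : Type*} (A : Finset S) (x : Config n S) : outSize A x ≤ n := by
  classical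
  exact (Finset.card_filter_le _ _).trans (by simp)

open Classical in
theorem sum_opinionSize {n : ℕ} {S : Type*} (A : Finset S) (x : Config n S) :
    ∑ i ∈ A, opinionSize x i + outSize A x = n := by
  have h1 : ∑ i ∈ A, opinionSize x i = #{v : Fin n | x v ∈ A} := by
    rw [Finset.card_eq_sum_card_fiberwise (f := x) (t := A) (fun v hv => by simpa using hv)]
    refine Finset.sum_congr rfl fun i hi => ?_
    unfold opinionSize
    congr 1
    ext v
    simp only [Finset.mem_filter, Finset.mem_univ, true_and]
    exact ⟨fun h => ⟨h ▸ hi, h⟩, fun h => h.2⟩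
  rw [h1, outSize_eq, Finset.card_filter_add_card_filter_not, Finset.card_univ, Fintype.card_fin]

open Classical in
theorem outSize_erase {n : ℕ} {S : Type*} {A : Finset S} {i : S} (hi : i ∈ A) (x : Config n S) :
    outSize (A.erase i) x = outSize A x + opinionSize x i := by
  have h1 := sum_opinionSize A x
  have h2 := sum_opinionSize (A.erase i) x
  rw [← Finset.add_sum_erase A _ hi] at h1
  omega

/-- By Cauchy-Schwarz, the sum of the squares of the opinion sizes is at least what it would be if
the nodes with opinions in `A` were evenly spread over `A`. -/
theorem sq_le_card_mul_card_eq {n : ℕ} {S : Type*} (A : Finset S) (x : Config n S) :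
    by classical exact ((n : ℝ) - outSize A x) ^ 2
      ≤ #A * #{t : Fin n × Fin n | x t.1 = x t.2} := by
  classical
  have h1 : (n : ℝ) - outSize A x = ∑ i ∈ A, (opinionSize x i : ℝ) := by
    rw [sub_eq_iff_eq_add]; exact_mod_cast (sum_opinionSize A x).symm
  rw [h1]
  refine sq_sum_le_card_mul_sum_sq.trans ?_
  refine mul_le_mul_of_nonneg_left ?_ (Nat.cast_nonneg _)
  have h2 : ∑ i ∈ A, opinionSize x i ^ 2
      = #{t : Fin n × Fin n | x t.1 = x t.2 ∧ x t.1 ∈ A} := by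
    rw [Finset.card_eq_sum_card_fiberwise (f := fun t : Fin n × Fin n => x t.1) (t := A)
      (fun v hv => by simp at hv; exact hv.2)]
    refine Finset.sum_congr rfl fun i hi => ?_
    unfold opinionSize
    rw [sq, ← Finset.card_product]
    congr 1
    ext ⟨a, b⟩
    simp only [Finset.mem_product, Finset.mem_filter, Finset.mem_univ, true_and]
    constructor
    · rintro ⟨rfl, h⟩; exact ⟨⟨h.symm, hi⟩, rfl⟩
    · rintro ⟨⟨h, -⟩, rfl⟩; exact ⟨rfl, h.symm⟩
  have h3 : #{t : Fin n × Fin n | x t.1 = x t.2 ∧ x t.1 ∈ A}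
      ≤ #{t : Fin n × Fin n | x t.1 = x t.2} := by
    apply Finset.card_le_card
    intro t ht
    simp only [Finset.mem_filter, Finset.mem_univ, true_and] at ht ⊢
    exact ht.1
  exact_mod_cast h2.le.trans h3

open Classical in
/-- A bound for the expected number of nodes with the property `p` after a round, which is useful
when few nodes are outside `A`. -/
theorem adoptProb_le_of_outSize {n : ℕ} [NeZero n] {S : Type*} {A : Finset S} (hA : A.Nonempty)
    (x : Config n S) (p : S → Prop) :
    n * adoptProb x p ≤ #{v | p (x v)}
      * (1 + #{v | p (x v)} / n - (1 - outSize A x / n) ^ 2 / #A) := by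
  have hn : (0 : ℝ) < n := by exact_mod_cast Nat.pos_of_ne_zero (NeZero.ne n)
  have hA0 : (0 : ℝ) < #A := by exact_mod_cast hA.card_pos
  refine (adoptProb_le x p).trans ?_
  refine mul_le_mul_of_nonneg_left ?_ (Nat.cast_nonneg _)
  have h := sq_le_card_mul_card_eq A x
  have : (1 - (outSize A x : ℝ) / n) ^ 2 / #A
      ≤ #{t : Fin n × Fin n | x t.1 = x t.2} / (n : ℝ) ^ 2 := by
    rw [div_le_div_iff₀ hA0 (by positivity)]
    have e : (1 - (outSize A x : ℝ) / n) ^ 2 * (n : ℝ) ^ 2 = ((n : ℝ) - outSize A x) ^ 2 := by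
      field_simp
    rw [e]
    linarith
  linarith

/-- The expectation of a function of the configuration after a round of the dynamics. -/
def roundE {n : ℕ} {S : Type*} (x : Config n S) (g : Config n S → ℝ) : ℝ :=
  (∑ s : Fin n → Fin 3 → Fin n, g fun v => majority3 (x (s v 0)) (x (s v 1)) (x (s v 2)))
    / (Fintype.card (Fin 3 → Fin n) : ℝ) ^ n

theorem roundE_add {n : ℕ} {S : Type*} (x : Config n S) (g g' : Config n S → ℝ) :
    roundE x (fun c => g c + g' c) = roundE x g + roundE x g' := by
  unfold roundE
  rw [Finset.sum_add_distrib, add_div]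

theorem roundE_const_mul {n : ℕ} {S : Type*} (x : Config n S) (a : ℝ) (g : Config n S → ℝ) :
    roundE x (fun c => a * g c) = a * roundE x g := by
  unfold roundE
  rw [← Finset.mul_sum, mul_div_assoc]

theorem roundE_const {n : ℕ} [NeZero n] {S : Type*} (x : Config n S) (a : ℝ) :
    roundE x (fun _ => a) = a := by
  unfold roundE
  simp only [Finset.sum_const, Finset.card_univ, nsmul_eq_mul, Fintype.card_fun, Nat.cast_pow,
    Fintype.card_fin]
  have : (n : ℝ) ≠ 0 := by exact_mod_cast NeZero.ne n
  field_simp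

open Classical in
theorem roundE_card {n : ℕ} [NeZero n] {S : Type*} (x : Config n S) (p : S → Prop) (f : ℕ → ℝ) :
    roundE x (fun c => f #{v | p (c v)}) = binE (adoptProb x p) n f := by
  unfold roundE
  rw [sum_card_filter_eq_binE
    (fun b : Fin 3 → Fin n => p (majority3 (x (b 0)) (x (b 1)) (x (b 2)))) n f]
  have : (Fintype.card (Fin 3 → Fin n) : ℝ) ≠ 0 := by exact_mod_cast Fintype.card_ne_zero
  unfold adoptProb
  field_simp

theorem adoptProb_le_one {n : ℕ} [NeZero n] {S : Type*} (x : Config n S) (p : S → Prop) :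
    adoptProb x p ≤ 1 := by
  classical
  unfold adoptProb
  refine div_le_one_of_le₀ ?_ (Nat.cast_nonneg _)
  exact_mod_cast Finset.card_le_univ _

theorem tsum_threeMajorityStep {n : ℕ} [NeZero n] {S : Type*} (x : Config n S)
    {g : Config n S → ℝ} (hg : ∀ c, 0 ≤ g c) :
    ∑' c, threeMajorityStep x c * ENNReal.ofReal (g c) = ENNReal.ofReal (roundE x g) := by
  classical
  have h1 : threeMajorityStep x = (PMF.uniformOfFintype (Fin n → Fin 3 → Fin n)).bind fun s =>
      PMF.pure fun v => majority3 (x (s v 0)) (x (s v 1)) (x (s v 2)) := rfl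
  rw [h1]
  simp only [PMF.bind_apply, ← ENNReal.tsum_mul_right]
  rw [ENNReal.tsum_comm]
  have h2 : ∀ s : Fin n → Fin 3 → Fin n, ∑' c : Config n S,
      PMF.uniformOfFintype (Fin n → Fin 3 → Fin n) s
        * PMF.pure (fun v => majority3 (x (s v 0)) (x (s v 1)) (x (s v 2))) c
          * ENNReal.ofReal (g c)
      = ENNReal.ofReal (g (fun v => majority3 (x (s v 0)) (x (s v 1)) (x (s v 2)))
          / (Fintype.card (Fin 3 → Fin n) : ℝ) ^ n) := by
    intro s
    rw [tsum_eq_single fun v => majority3 (x (s v 0)) (x (s v 1)) (x (s v 2))]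
    · rw [PMF.pure_apply, if_pos rfl, mul_one, PMF.uniformOfFintype_apply, div_eq_inv_mul,
        ENNReal.ofReal_mul (by positivity), ENNReal.ofReal_inv_of_pos]
      · congr 2
        rw [Fintype.card_fun, Fintype.card_fin]
        norm_cast
      · have : (0 : ℝ) < Fintype.card (Fin 3 → Fin n) := by exact_mod_cast Fintype.card_pos
        positivity
    · intro c hc
      rw [PMF.pure_apply, if_neg hc, mul_zero, zero_mul]
  simp only [h2]
  rw [tsum_fintype, ← ENNReal.ofReal_sum_of_nonneg, roundE, Finset.sum_div]
  intro s _
  exact div_nonneg (hg _) (by positivity)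

/-! ### Tracking the competing opinions -/

/-- The size of the smallest opinion of `A`. -/
def minSize {n : ℕ} {S : Type*} (A : Finset S) (x : Config n S) : ℕ :=
  sInf (opinionSize x '' A)

theorem minSize_le {n : ℕ} {S : Type*} {A : Finset S} {i : S} (hi : i ∈ A) (x : Config n S) :
    minSize A x ≤ opinionSize x i :=
  Nat.sInf_le ⟨i, hi, rfl⟩

theorem exists_opinionSize_eq_minSize {n : ℕ} {S : Type*} {A : Finset S} (hA : A.Nonempty)
    (x : Config n S) : ∃ i ∈ A, opinionSize x i = minSize A x := by
  obtain ⟨i, hi⟩ := hA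
  obtain ⟨i, hi, h⟩ := Nat.sInf_mem (s := opinionSize x '' A) ⟨_, i, hi, rfl⟩
  exact ⟨i, hi, h⟩

theorem minSize_le_avg {n : ℕ} {S : Type*} {A : Finset S} (hA : A.Nonempty) (x : Config n S) :
    (minSize A x : ℝ) ≤ n / #A := by
  have h0 : (0 : ℝ) < #A := by exact_mod_cast hA.card_pos
  rw [le_div_iff₀ h0]
  have h1 : #A • minSize A x ≤ ∑ i ∈ A, opinionSize x i :=
    Finset.card_nsmul_le_sum _ _ _ fun i hi => minSize_le hi x
  have h2 := sum_opinionSize A x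
  have : minSize A x * #A ≤ n := by rw [smul_eq_mul, mul_comm] at h1; omega
  exact_mod_cast this

open Classical in
/-- Changing `f` nodes changes the number of nodes with a given property by at most `f`. -/
theorem card_le_card_add_of_changed_le {n f : ℕ} {S : Type*} {c c' : Config n S}
    (h : #{v | c' v ≠ c v} ≤ f) (p : S → Prop) :
    #{v | p (c' v)} ≤ #{v | p (c v)} + f := by
  have : ({v | p (c' v)} : Finset (Fin n))
      ⊆ ({v | p (c v)} : Finset (Fin n)) ∪ ({v | c' v ≠ c v} : Finset (Fin n)) := by
    intro v hv
    simp only [Finset.mem_union, Finset.mem_filter, Finset.mem_univ, true_and] at hv ⊢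
    by_cases h : c' v = c v
    · left; rwa [← h]
    · right; exact h
  exact (Finset.card_le_card this).trans ((Finset.card_union_le _ _).trans (by omega))

open Classical in
theorem opinionSize_le_add_of_changed_le {n f : ℕ} {S : Type*} {c c' : Config n S}
    (h : #{v | c' v ≠ c v} ≤ f) (i : S) : opinionSize c' i ≤ opinionSize c i + f :=
  card_le_card_add_of_changed_le h fun s => s = i

open Classical in
theorem outSize_le_add_of_changed_le {n f : ℕ} {S : Type*} {c c' : Config n S}
    (h : #{v | c' v ≠ c v} ≤ f) (A : Finset S) : outSize A c' ≤ outSize A c + f :=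
  by unfold outSize; convert card_le_card_add_of_changed_le h fun s => s ∉ A

/-- The data for tracking the competing opinions: the valid opinions, a bound `L` on the size of
the set of nodes outside the competition, the threshold `θ` of the almost-consensus, the number
`f` of nodes the adversary controls, the round `t₀` by which the competition has to be over, and
the round `t₁` up to which the almost-consensus is observed. -/
structure Tracking (S : Type*) where
  valid : Finset S
  L : ℝ
  θ : ℝ
  f : ℕ
  t₀ : ℕ
  t₁ : ℕ

namespace Tracking

variable {S : Type*} (P : Tracking S)

/-- The number of nodes tolerated outside a set of `j` competing opinions. It grows by `L / k`
whenever a competitor is dropped. -/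
def outBound (j : ℕ) : ℝ := P.L * (2 - j / #P.valid)

/-- The set `A` of competing opinions is in order: few nodes are outside, and each competitor is
still too large to be dropped. -/
def Good {n : ℕ} (A : Finset S) (x : Config n S) : Prop :=
  A.Nonempty ∧ (outSize A x : ℝ) ≤ P.outBound #A
    ∧ (2 ≤ #A → ∀ i ∈ A, P.L / #P.valid < opinionSize x i)

/-- `A'` can replace `A` as the set of competing opinions at the end `x` of round `t`. -/
def IsNext {n : ℕ} (t : ℕ) (A : Finset S) (x : Config n S) (A' : Finset S) : Prop :=
  A' ⊆ A ∧ P.Good A' x ∧ (#A = 1 → (outSize A x : ℝ) ≤ P.θ) ∧ (t = P.t₀ → #A' = 1)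

open Classical in
/-- The competing opinions after round `t`, or `none` if something went wrong. -/
def next {n : ℕ} (t : ℕ) (A : Finset S) (x : Config n S) : Option (Finset S) :=
  if h : ∃ A', P.IsNext t A x A' then some h.choose else none

theorem isNext_of_next_eq_some {n : ℕ} {t : ℕ} {A A' : Finset S} {x : Config n S}
    (h : P.next t A x = some A') : P.IsNext t A x A' := by
  unfold next at h
  split_ifs at h with h'
  have := h'.choose_spec
  rwa [Option.some.inj h] at this

theorem not_isNext_of_next_eq_none {n : ℕ} {t : ℕ} {A : Finset S} {x : Config n S}
    (h : P.next t A x = none) (A' : Finset S) : ¬ P.IsNext t A x A' := by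
  unfold next at h
  split_ifs at h with h'
  exact fun h2 => h' ⟨A', h2⟩

/-- The competing opinions along a history. The tracking stops after round `t₁`. -/
def tracked {n : ℕ} : (t : ℕ) → (Fin (t + 1) → Config n S × Config n S) → Option (Finset S)
  | 0, h => P.next 0 P.valid (h 0).2
  | t + 1, h =>
    if t + 1 ≤ P.t₁ then
      (tracked t (Fin.init h)).bind fun A => P.next (t + 1) A (h (Fin.last (t + 1))).2
    else tracked t (Fin.init h)

/-- Dropping the competitors that have become too small. -/
theorem exists_good {n : ℕ} {A : Finset S} (hA : A.Nonempty)
    {x : Config n S} (h : (outSize A x : ℝ) ≤ P.outBound #A) : ∃ A' ⊆ A, P.Good A' x := by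
  classical
  induction hj : #A using Nat.strong_induction_on generalizing A with
  | _ j ih =>
    by_cases hgood : P.Good A x
    · exact ⟨A, subset_rfl, hgood⟩
    · have : ∃ i ∈ A, 2 ≤ #A ∧ (opinionSize x i : ℝ) ≤ P.L / #P.valid := by
        by_contra hcon
        push Not at hcon
        exact hgood ⟨hA, h, fun h2 i hi => hcon i hi h2⟩
      obtain ⟨i, hi, h2, hi'⟩ := this
      have hcard := Finset.card_erase_of_mem hi
      have hbound : (outSize (A.erase i) x : ℝ) ≤ P.outBound #(A.erase i) := by
        rw [outSize_erase hi, hcard]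
        push_cast
        unfold outBound at h ⊢
        rw [Nat.cast_sub (by omega)]
        have : P.L * (2 - ((#A : ℝ) - (1 : ℕ)) / #P.valid)
            = P.L * (2 - #A / #P.valid) + P.L / #P.valid := by push_cast; ring
        rw [this]
        linarith
      obtain ⟨A', h1, h3⟩ := ih (#(A.erase i)) (by omega)
        (Finset.card_pos.1 (by omega)) hbound rfl
      exact ⟨A', h1.trans (Finset.erase_subset _ _), h3⟩

theorem tracked_spec {n : ℕ} (h01 : P.t₀ < P.t₁) (t : ℕ)
    (h : Fin (t + 1) → Config n S × Config n S) {A : Finset S} (hA : P.tracked t h = some A) :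
    A.Nonempty ∧ A ⊆ P.valid ∧ (t ≤ P.t₁ → P.Good A (h (Fin.last t)).2) ∧ (P.t₀ ≤ t → #A = 1) ∧
      ∀ s : Fin (t + 1), P.t₀ < s → (s : ℕ) ≤ P.t₁ → (outSize A (h s).2 : ℝ) ≤ P.θ := by
  induction t generalizing A with
  | zero =>
    obtain ⟨h1, h2, h3, h4⟩ := P.isNext_of_next_eq_some hA
    refine ⟨h2.1, h1, fun _ => h2, fun h => h4 (by omega), fun s hs => ?_⟩
    have := s.2
    omega
  | succ t ih =>
    rw [tracked] at hA
    split_ifs at hA with ht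
    · obtain ⟨B, hB, hBA⟩ := Option.bind_eq_some_iff.1 hA
      obtain ⟨i1, i2, i3, i4, i5⟩ := ih _ hB
      obtain ⟨h1, h2, h3, h4⟩ := P.isNext_of_next_eq_some hBA
      have hcard : P.t₀ ≤ t → A = B := fun h =>
        Finset.eq_of_subset_of_card_le h1 (by rw [i4 h]; exact h2.1.card_pos)
      refine ⟨h2.1, h1.trans i2, fun _ => h2, fun h => ?_, fun s => ?_⟩
      · rcases h.eq_or_lt with h | h
        · exact h4 h.symm
        · rw [hcard (by omega)]; exact i4 (by omega)
      · induction s using Fin.lastCases with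
        | last =>
          intro h5 h6
          simp only [Fin.val_last] at h5
          rw [hcard (by omega)]
          exact h3 (i4 (by omega))
        | cast s =>
          intro h5 h6
          simp only [Fin.val_castSucc] at h5 h6
          have := s.2
          rw [hcard (by omega)]
          exact i5 s h5 h6
    · obtain ⟨i1, i2, i3, i4, i5⟩ := ih _ hA
      refine ⟨i1, i2, fun h => absurd h ht, fun h => i4 (by omega), fun s => ?_⟩
      induction s using Fin.lastCases with
      | last =>
        intro h5 h6
        simp only [Fin.val_last] at h6
        omega
      | cast s => exact i5 s

/-- If the tracking succeeds, then the last competitor has reached a stable almost-consensus. -/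
theorem reachesStableAlmostConsensus {n N : ℕ} {x₀ : Config n S} {B : ℝ} {d : ℕ}
    (h01 : P.t₀ < P.t₁) (hV : ↑P.valid = activeOpinions x₀) (hB : (P.t₀ : ℝ) + 1 ≤ B)
    (hd : P.t₁ = P.t₀ + 1 + d) (hN : P.t₁ ≤ N) {h : Fin (N + 1) → Config n S × Config n S}
    (hA : P.tracked N h ≠ none) : ReachesStableAlmostConsensus P.θ x₀ B d h := by
  classical
  obtain ⟨A, hA⟩ := Option.ne_none_iff_exists'.1 hA
  obtain ⟨h1, h2, -, h4, h5⟩ := P.tracked_spec h01 N h hA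
  obtain ⟨m, rfl⟩ := Finset.card_eq_one.1 (h4 (by omega))
  have hm : m ∈ activeOpinions x₀ := by
    rw [← hV]; exact h2 (Finset.mem_singleton_self m)
  refine ⟨P.t₀ + 1, by exact_mod_cast hB, m, hm, fun t ht1 ht2 => ?_⟩
  have h6 := h5 t (by omega) (by omega)
  refine ⟨fun i hi => le_trans ?_ h6, le_trans ?_ h6⟩
  · rw [Nat.cast_le]
    apply Finset.card_le_card
    intro v hv
    simp only [Finset.mem_filter, Finset.mem_univ, true_and, Finset.mem_singleton] at hv ⊢
    rwa [hv]
  · rw [Nat.cast_le]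
    apply Finset.card_le_card
    intro v hv
    simp only [Finset.mem_filter, Finset.mem_univ, true_and, Finset.mem_singleton] at hv ⊢
    rintro rfl
    exact hv hm

end Tracking

/-! ### The potential of the tracking -/

theorem sizePotential_nonneg (a μ X : ℝ) : 0 ≤ sizePotential a μ X := Real.sqrt_nonneg _

theorem one_le_sqrt_mul_sizePotential {n : ℕ} (hn : 2 ≤ n) {μ X : ℝ} (hX : 0 ≤ X) (hXμ : X ≤ μ)
    (hμ : μ ≤ n) : 1 ≤ Real.sqrt n * sizePotential (10 ^ 6 * n) μ X := by
  have hn0 : (2 : ℝ) ≤ n := by exact_mod_cast hn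
  unfold sizePotential
  rw [← Real.sqrt_mul (by positivity)]
  refine Real.one_le_sqrt.2 ?_
  have h1 : (μ - X) ^ 2 ≤ (n : ℝ) ^ 2 := by
    apply pow_le_pow_left₀ <;> linarith
  have h2 : 1 ≤ (n : ℝ) * (10 ^ 6 * n / ((μ - X) ^ 2 + 10 ^ 6 * n)) := by
    rw [← mul_div_assoc, one_le_div (by positivity)]
    nlinarith
  rw [← mul_assoc]
  exact one_le_mul_of_one_le_of_one_le h2 (by linarith)

theorem sqrt_mul_sizePotential_le {n : ℕ} (hn : 2 ≤ n) {μ X : ℝ} (hX : 0 ≤ X) (hXn : X ≤ n) :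
    Real.sqrt n * sizePotential (10 ^ 6 * n) μ X ≤ 2 * n := by
  have hn0 : (2 : ℝ) ≤ n := by exact_mod_cast hn
  unfold sizePotential
  rw [← Real.sqrt_mul (by positivity)]
  refine Real.sqrt_le_iff.2 ⟨by positivity, ?_⟩
  have h2 : 10 ^ 6 * n / ((μ - X) ^ 2 + 10 ^ 6 * n) ≤ 1 := by
    rw [div_le_one (by positivity)]; nlinarith [sq_nonneg (μ - X)]
  have h3 : 10 ^ 6 * n / ((μ - X) ^ 2 + 10 ^ 6 * n) * (1 + X) ≤ 1 * (1 + n) := by gcongr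
  nlinarith

namespace Tracking

variable {S : Type*} (P : Tracking S)

/-- A bound for the probability that the tracking fails from round `t` on: `δ` for every
remaining round, and a term for the event that several competitors are left in round `t₀`.
The latter loses a factor `2 * n` with every dropped competitor, and a factor
`1 - 10⁻¹¹ / k` with every round. -/
def potential {n : ℕ} (δ : ℝ) (t : ℕ) (o : Option (Finset S)) (x : Config n S) : ℝ :=
  match o with
  | none => 1
  | some A => ((P.t₁ - t : ℕ) : ℝ) * δ + if 2 ≤ #A ∧ t ≤ P.t₀ then
      (1 - 1 / 10 ^ 11 / (#P.valid : ℝ)) ^ (P.t₀ - t) * ((2 * n : ℝ) ^ #A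
        * (Real.sqrt n * sizePotential (10 ^ 6 * n) (n / #A) (minSize A x))) else 0

open Classical in
/-- The requirements on the parameters: the adversary is weak, few nodes are outside the
competition, and the number of nodes outside exceeds its bound with probability at most `δ` in one
round. In `tail` and `tail_one`, `Q` is the number of nodes outside and `q` the probability that
one node adopts an opinion from outside; `tail_one` concerns a single competitor, when the
threshold `θ` of the almost-consensus has to be respected as well. -/
structure IsAdmissible (n : ℕ) (δ : ℝ) : Prop where
  delta_nonneg : 0 ≤ δ
  lt : P.t₀ < P.t₁
  valid_nonempty : P.valid.Nonempty
  L_nonneg : 0 ≤ P.L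
  f_le : (P.f : ℝ) ≤ P.L / #P.valid / #P.valid / (2 * 10 ^ 12)
  f_le_theta : (P.f : ℝ) ≤ P.θ
  L_le : 8 * 10 ^ 12 * P.L ≤ Real.sqrt n
  tail : ∀ (j : ℕ) (Q q : ℝ), 2 ≤ j → j ≤ #P.valid → 0 ≤ q → q ≤ 1 → 0 ≤ Q → Q ≤ P.outBound j →
    n * q ≤ Q * (1 + Q / n - (1 - Q / n) ^ 2 / j) →
    binE q n (fun N => if P.outBound j < N + P.f then 1 else 0) ≤ δ
  tail_one : ∀ Q q : ℝ, 0 ≤ q → q ≤ 1 → 0 ≤ Q → Q ≤ P.outBound 1 →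
    n * q ≤ Q * (1 + Q / n - (1 - Q / n) ^ 2) →
    binE q n (fun N => if (N : ℝ) + P.f ≤ P.outBound 1 ∧ (N : ℝ) + P.f ≤ P.θ then 0 else 1) ≤ δ

variable {P}

theorem IsAdmissible.rate_nonneg {n : ℕ} {δ : ℝ} (hP : P.IsAdmissible n δ) :
    (0 : ℝ) ≤ 1 - 1 / 10 ^ 11 / #P.valid := by
  have h1 : (1 : ℝ) ≤ #P.valid := by exact_mod_cast hP.valid_nonempty.card_pos
  have : 1 / 10 ^ 11 / (#P.valid : ℝ) ≤ 1 / 10 ^ 11 / 1 := by gcongr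
  linarith

open Classical in
/-- The potential after a round in which at least two opinions compete. -/
theorem potential_next_le {n : ℕ} (hn : 2 ≤ n) {δ : ℝ} (hP : P.IsAdmissible n δ) {t : ℕ}
    {A : Finset S} (hA : 2 ≤ #A) {i : S} (hi : i ∈ A) {c c' : Config n S}
    (hc : #{v | c' v ≠ c v} ≤ P.f) :
    P.potential δ (t + 1) (P.next (t + 1) A c') c'
      ≤ (if P.outBound #A < outSize A c + P.f then 1 else 0) + (((P.t₁ - (t + 1) : ℕ) : ℝ) * δ
        + (1 - 1 / 10 ^ 11 / (#P.valid : ℝ)) ^ (P.t₀ - (t + 1)) * (2 * n : ℝ) ^ #A * Real.sqrt n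
          * sizePotential (10 ^ 6 * n) (n / #A) (min (opinionSize c i + P.f) (n / #A))) := by
  have hδ := hP.delta_nonneg
  have hρ := hP.rate_nonneg
  have hAne : A.Nonempty := ⟨i, hi⟩
  have hn0 : (2 : ℝ) ≤ n := by exact_mod_cast hn
  have hA1 : (1 : ℝ) ≤ #A := by exact_mod_cast hAne.card_pos
  have hμ : (n : ℝ) / #A ≤ n := div_le_self (by positivity) hA1
  set ρ := 1 - 1 / 10 ^ 11 / (#P.valid : ℝ)
  set Z : ℝ := min (opinionSize c i + P.f) (n / #A) with hZ
  have hZ0 : 0 ≤ Z := le_min (by positivity) (by positivity)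
  set E : ℝ := Real.sqrt n * sizePotential (10 ^ 6 * n) (n / #A) Z with hE
  have hE1 : 1 ≤ E := one_le_sqrt_mul_sizePotential hn hZ0 (min_le_right _ _) hμ
  have hpow : (1 : ℝ) ≤ (2 * n) ^ #A := one_le_pow₀ (by linarith)
  have ht1 : (0 : ℝ) ≤ ((P.t₁ - (t + 1) : ℕ) : ℝ) * δ := by positivity
  have hind : (0 : ℝ) ≤ if P.outBound #A < outSize A c + P.f then 1 else 0 := by
    split_ifs <;> norm_num
  have hcpl : ρ ^ (P.t₀ - (t + 1)) * (2 * n : ℝ) ^ #A * Real.sqrt n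
      * sizePotential (10 ^ 6 * n) (n / #A) Z = ρ ^ (P.t₀ - (t + 1)) * ((2 * n : ℝ) ^ #A * E) := by
    rw [hE]; ring
  rw [hcpl]
  have hmain : 0 ≤ ρ ^ (P.t₀ - (t + 1)) * ((2 * n : ℝ) ^ #A * E) := by positivity
  rcases hnext : P.next (t + 1) A c' with _ | A'
  · simp only [potential]
    by_cases hout : P.outBound #A < outSize A c + P.f
    · rw [if_pos hout]; linarith
    · have h1 : (outSize A c' : ℝ) ≤ P.outBound #A := by
        refine le_trans ?_ (not_lt.1 hout)
        exact_mod_cast outSize_le_add_of_changed_le hc A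
      obtain ⟨B, hBA, hB⟩ := P.exists_good hAne h1
      have h2 := P.not_isNext_of_next_eq_none hnext B
      -- The only way left to fail is to have several competitors at the deadline.
      have h3 : t + 1 = P.t₀ := by
        by_contra h3
        exact h2 ⟨hBA, hB, fun h => by omega, fun h => absurd h h3⟩
      have h4 : P.t₀ - (t + 1) = 0 := by omega
      rw [h4, pow_zero, one_mul] at *
      have : 1 ≤ (2 * n : ℝ) ^ #A * E := one_le_mul_of_one_le_of_one_le hpow hE1
      linarith
  · obtain ⟨h1, h2, h3, h4⟩ := P.isNext_of_next_eq_some hnext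
    simp only [potential]
    rw [show 1 - 1 / 10 ^ 11 / (#P.valid : ℝ) = ρ from rfl]
    by_cases h5 : 2 ≤ #A' ∧ t + 1 ≤ P.t₀
    · rw [if_pos h5]
      have hcount : (minSize A' c' : ℝ) ≤ n / #A' := minSize_le_avg h2.1 c'
      have hA'1 : (1 : ℝ) ≤ #A' := by exact_mod_cast h2.1.card_pos
      have key : (2 * n : ℝ) ^ #A' * (Real.sqrt n
          * sizePotential (10 ^ 6 * n) (n / #A') (minSize A' c')) ≤ (2 * n : ℝ) ^ #A * E := by
        rcases h1.eq_or_ssubset with rfl | hss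
        · rw [hE]
          gcongr
          have ha : (0 : ℝ) < 10 ^ 6 * n := by linarith
          refine sizePotential_mono ha (Nat.cast_nonneg _) (le_min ?_ hcount)
            (min_le_right _ _)
          refine (Nat.cast_le.2 (minSize_le hi c')).trans ?_
          exact_mod_cast opinionSize_le_add_of_changed_le hc i
        · have hlt := Finset.card_lt_card hss
          have h6 : Real.sqrt n * sizePotential (10 ^ 6 * n) (n / #A') (minSize A' c') ≤ 2 * n :=
            sqrt_mul_sizePotential_le hn (Nat.cast_nonneg _)
              (hcount.trans (div_le_self (by positivity) hA'1))
          calc (2 * n : ℝ) ^ #A' * (Real.sqrt n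
                * sizePotential (10 ^ 6 * n) (n / #A') (minSize A' c'))
              ≤ (2 * n : ℝ) ^ #A' * (2 * n) := by gcongr
            _ = (2 * n : ℝ) ^ (#A' + 1) := by rw [pow_succ]
            _ ≤ (2 * n : ℝ) ^ #A := pow_le_pow_right₀ (by linarith) hlt
            _ ≤ (2 * n : ℝ) ^ #A * E := le_mul_of_one_le_right (by positivity) hE1
      have := mul_le_mul_of_nonneg_left key (pow_nonneg hρ (P.t₀ - (t + 1)))
      linarith
    · rw [if_neg h5]; linarith

open Classical in
/-- The potential after a round in which the competition is over. -/
theorem potential_next_le_of_card_eq_one {n : ℕ} {δ : ℝ} (hP : P.IsAdmissible n δ) (t : ℕ)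
    {A : Finset S} (hA : #A = 1) {c c' : Config n S}
    (hc : #{v | c' v ≠ c v} ≤ P.f) :
    P.potential δ (t + 1) (P.next (t + 1) A c') c'
      ≤ (if (outSize A c : ℝ) + P.f ≤ P.outBound 1 ∧ (outSize A c : ℝ) + P.f ≤ P.θ then 0 else 1)
        + ((P.t₁ - (t + 1) : ℕ) : ℝ) * δ := by
  have hδ := hP.delta_nonneg
  have hAne : A.Nonempty := Finset.card_pos.1 (by omega)
  have ht1 : (0 : ℝ) ≤ ((P.t₁ - (t + 1) : ℕ) : ℝ) * δ := by positivity
  rcases hnext : P.next (t + 1) A c' with _ | A'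
  · simp only [potential]
    split_ifs with h
    · have h1 : (outSize A c' : ℝ) ≤ outSize A c + P.f := by
        exact_mod_cast outSize_le_add_of_changed_le hc A
      exact absurd ⟨subset_rfl, ⟨hAne, by rw [hA]; linarith, fun h => by omega⟩,
        fun _ => by linarith, fun _ => hA⟩ (P.not_isNext_of_next_eq_none hnext A)
    · linarith
  · obtain ⟨h1, h2, h3, h4⟩ := P.isNext_of_next_eq_some hnext
    have := Finset.card_le_card h1
    simp only [potential]
    rw [if_neg (by omega)]
    split_ifs <;> linarith

end Tracking

/-! ### The potential is a supermartingale -/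

theorem roundE_opinionSize {n : ℕ} [NeZero n] {S : Type*} (x : Config n S) (i : S) (f : ℕ → ℝ) :
    roundE x (fun c => f (opinionSize c i)) = binE (adoptProb x (· = i)) n f :=
  roundE_card x (· = i) f

theorem roundE_outSize {n : ℕ} [NeZero n] {S : Type*} (x : Config n S) (A : Finset S)
    (f : ℕ → ℝ) : roundE x (fun c => f (outSize A c)) = binE (adoptProb x (· ∉ A)) n f := by
  rw [← roundE_card x (· ∉ A) f]
  unfold outSize
  congr! 5

theorem adoptProb_eq_le {n : ℕ} [NeZero n] {S : Type*} {A : Finset S} (hA : A.Nonempty)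
    (x : Config n S) (i : S) : n * adoptProb x (· = i)
      ≤ opinionSize x i * (1 + opinionSize x i / n - (1 - outSize A x / n) ^ 2 / #A) :=
  adoptProb_le_of_outSize hA x (· = i)

theorem adoptProb_notMem_le {n : ℕ} [NeZero n] {S : Type*} {A : Finset S} (hA : A.Nonempty)
    (x : Config n S) : n * adoptProb x (· ∉ A)
      ≤ outSize A x * (1 + outSize A x / n - (1 - outSize A x / n) ^ 2 / #A) := by
  have h := adoptProb_le_of_outSize hA x (· ∉ A)
  unfold outSize at h ⊢
  convert h

namespace Tracking

variable {S : Type*} {P : Tracking S}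

theorem IsAdmissible.outBound_le {n : ℕ} {δ : ℝ} (hP : P.IsAdmissible n δ) (j : ℕ) :
    P.outBound j ≤ 2 * P.L := by
  unfold outBound
  have := hP.L_nonneg
  have h : (0 : ℝ) ≤ j / #P.valid := by positivity
  nlinarith

/-- One round of the dynamics, from the smallest competitor's point of view. -/
theorem roundE_sizePotential_le {n : ℕ} [NeZero n] (hn : 2 ≤ n) {δ : ℝ}
    (hP : P.IsAdmissible n δ) {A : Finset S} (hA : 2 ≤ #A) (hAV : A ⊆ P.valid) {x : Config n S}
    (hgood : P.Good A x) {i : S} (hi : i ∈ A) (hmin : opinionSize x i = minSize A x) :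
    roundE x (fun c => sizePotential (10 ^ 6 * n) (n / #A) (min (opinionSize c i + P.f) (n / #A)))
      ≤ (1 - 1 / 10 ^ 11 / (#P.valid : ℝ))
        * sizePotential (10 ^ 6 * n) (n / #A) (minSize A x) := by
  have hn0 : (2 : ℝ) ≤ n := by exact_mod_cast hn
  have hnpos : (0 : ℝ) < n := by linarith
  have hL := hP.L_nonneg
  have hj : (2 : ℝ) ≤ #A := by exact_mod_cast hA
  have hjk : (#A : ℝ) ≤ #P.valid := by exact_mod_cast Finset.card_le_card hAV
  obtain ⟨j, hjdef⟩ : ∃ j : ℝ, j = #A := ⟨_, rfl⟩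
  obtain ⟨k, hkdef⟩ : ∃ k : ℝ, k = #P.valid := ⟨_, rfl⟩
  rw [← hjdef] at hj hjk ⊢
  rw [← hkdef] at hjk ⊢
  have hj0 : 0 < j := by linarith
  have hk0 : 0 < k := by linarith
  have hXgt := hgood.2.2 hA i hi
  rw [hmin, ← hkdef] at hXgt
  have hXavg : (minSize A x : ℝ) ≤ n / j := by rw [hjdef]; exact minSize_le_avg ⟨i, hi⟩ x
  have hX1 : (1 : ℝ) ≤ minSize A x := by
    have : (0 : ℝ) < minSize A x := lt_of_le_of_lt (by positivity) hXgt
    exact_mod_cast this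
  have hadopt := adoptProb_eq_le ⟨i, hi⟩ x i
  rw [hmin, ← hjdef] at hadopt
  have hQ : (outSize A x : ℝ) ≤ 2 * P.L := hgood.2.1.trans (hP.outBound_le _)
  have hQn : (outSize A x : ℝ) ≤ n := by exact_mod_cast outSize_le A x
  obtain ⟨X, hX⟩ : ∃ X : ℝ, X = minSize A x := ⟨_, rfl⟩
  obtain ⟨w, hw⟩ : ∃ w : ℝ, w = outSize A x / n := ⟨_, rfl⟩
  rw [← hX] at hXgt hXavg hX1 hadopt ⊢
  rw [← hw] at hadopt
  have hw0 : 0 ≤ w := by rw [hw]; positivity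
  have hw1 : w ≤ 1 := by rw [hw, div_le_one hnpos]; exact hQn
  have hwL : w * n ≤ 2 * P.L := by rw [hw, div_mul_cancel₀ _ hnpos.ne']; exact hQ
  have hX0 : 0 < X := by linarith
  obtain ⟨e, he⟩ : ∃ e, e = (1 - (1 - w) ^ 2) / j := ⟨_, rfl⟩
  have he0 : 0 ≤ e := by rw [he]; apply div_nonneg _ hj0.le; nlinarith
  have he1 : e ≤ 1 / j := by
    rw [he]; gcongr; nlinarith [sq_nonneg (1 - w)]
  have heL : e * n ≤ 4 * P.L / j := by
    have : e ≤ 2 * w / j := by rw [he]; gcongr; nlinarith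
    calc e * n ≤ 2 * w / j * n := by gcongr
      _ = 2 * (w * n) / j := by ring
      _ ≤ 2 * (2 * P.L) / j := by gcongr
      _ = _ := by ring
  have hsq : Real.sqrt n ≤ n := by
    rw [Real.sqrt_le_left hnpos.le]; nlinarith
  have hLs := hP.L_le
  obtain ⟨q, hq⟩ : ∃ q, q = X * (1 - (n / j - X) / n + e) / n := ⟨_, rfl⟩
  have hnq : n * q = X * (1 - (n / j - X) / n + e) := by rw [hq]; field_simp
  have hqle : adoptProb x (· = i) ≤ q := by
    refine le_of_mul_le_mul_left (hadopt.trans (le_of_eq ?_)) hnpos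
    rw [hnq, he]; field_simp; ring
  have hq1 : q ≤ 1 := by
    have h1 : X * (1 - (n / j - X) / n + e) ≤ (n / j) * (1 + e) := by
      have : 0 ≤ (n / j - X) / n := div_nonneg (by linarith) hnpos.le
      calc X * (1 - (n / j - X) / n + e) ≤ X * (1 + e) := by gcongr; linarith
        _ ≤ (n / j) * (1 + e) := by gcongr
    have h2 : (n / j) * (1 + e) ≤ (n / 2) * (1 + 1) := by
      gcongr
      exact he1.trans ((div_le_one hj0).2 (by linarith))
    refine le_of_mul_le_mul_left (a := (n : ℝ)) ?_ hnpos
    linarith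
  have hf1 : (P.f : ℝ) ≤ P.L / k / k / (2 * 10 ^ 12) := by
    have := hP.f_le; rwa [← hkdef] at this
  have hfX : (P.f : ℝ) ≤ X / j / (2 * 10 ^ 12) := by
    refine hf1.trans ?_
    gcongr
  have hfn : (P.f : ℝ) ≤ Real.sqrt n / j / (2 * 10 ^ 12) := by
    refine hf1.trans ?_
    gcongr
    have : P.L / k ≤ P.L := div_le_self hL (by linarith)
    linarith
  have heX : X * e ≤ X / j / (2 * 10 ^ 12) := by
    have : e ≤ 1 / j / (2 * 10 ^ 12) := by
      refine le_of_mul_le_mul_right ?_ hnpos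
      refine heL.trans ?_
      calc 4 * P.L / j = 8 * 10 ^ 12 * P.L / j / (2 * 10 ^ 12) := by ring
        _ ≤ n / j / (2 * 10 ^ 12) := by gcongr; linarith
        _ = _ := by ring
    calc X * e ≤ X * (1 / j / (2 * 10 ^ 12)) := by gcongr
      _ = _ := by ring
  have hen : X * e ≤ Real.sqrt n / j / (2 * 10 ^ 12) := by
    calc X * e ≤ n / j * e := by gcongr
      _ = e * n / j := by ring
      _ ≤ 4 * P.L / j / j := by gcongr
      _ ≤ 4 * P.L / j := div_le_self (by positivity) (by linarith)
      _ = 8 * 10 ^ 12 * P.L / j / (2 * 10 ^ 12) := by ring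
      _ ≤ Real.sqrt n / j / (2 * 10 ^ 12) := by gcongr
  have hcore := binE_sizePotential_le (n := n) (f := P.f) (j := j) (X := X) (q := q)
    (η := P.f + X * e) (by omega) hj hX1 hXavg (by nlinarith) (by rw [hnq]; ring)
    (by linarith) (by linarith)
  have hmono : Monotone fun N : ℕ =>
      sizePotential (10 ^ 6 * n) (n / j) (min ((N : ℝ) + P.f) (n / j)) := by
    intro a b hab
    have : (a : ℝ) ≤ b := by exact_mod_cast hab
    refine sizePotential_mono (by positivity) (le_min (by positivity) (by positivity)) ?_
      (min_le_right _ _)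
    exact min_le_min_right _ (by linarith)
  have hfin := binE_mono_prob (adoptProb_nonneg x (· = i)) hqle hq1 n hmono
  refine (roundE_opinionSize x i _).le.trans (hfin.trans (hcore.trans ?_))
  refine mul_le_mul_of_nonneg_right ?_ (sizePotential_nonneg _ _ _)
  have : 1 / 10 ^ 11 / k ≤ 1 / 10 ^ 11 / j := by gcongr
  linarith

open Classical in
/-- The potential is a supermartingale, whatever the adversary does. -/
theorem exists_roundE_le_potential {n : ℕ} [NeZero n] (hn : 2 ≤ n) {δ : ℝ}
    (hP : P.IsAdmissible n δ) {t : ℕ} (ht : t < P.t₁) {A : Finset S} (hAV : A ⊆ P.valid)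
    {x : Config n S} (hgood : P.Good A x) (h1 : P.t₀ ≤ t → #A = 1) :
    ∃ G : Config n S → ℝ, (∀ c, 0 ≤ G c) ∧ (∀ c c' : Config n S, #{v | c' v ≠ c v} ≤ P.f →
      P.potential δ (t + 1) (P.next (t + 1) A c') c' ≤ G c) ∧
      roundE x G ≤ P.potential δ t (some A) x := by
  have hδ := hP.delta_nonneg
  have hρ := hP.rate_nonneg
  have hcast : ((P.t₁ - t : ℕ) : ℝ) = ((P.t₁ - (t + 1) : ℕ) : ℝ) + 1 := by
    rw [show P.t₁ - t = (P.t₁ - (t + 1)) + 1 by omega]; push_cast; ring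
  have ht1 : (0 : ℝ) ≤ ((P.t₁ - (t + 1) : ℕ) : ℝ) * δ := by positivity
  have hQ2 := adoptProb_notMem_le hgood.1 x
  rcases (show #A = 1 ∨ 2 ≤ #A by have := hgood.1.card_pos; omega) with hA | hA
  · refine ⟨_, fun c => ?_, fun c c' hc => potential_next_le_of_card_eq_one hP t hA hc, ?_⟩
    · split_ifs <;> linarith
    · rw [roundE_add, roundE_const]
      simp only [potential]
      rw [if_neg (by omega), hcast]
      have hg := hgood.2.1
      rw [hA, Nat.cast_one, div_one] at hQ2
      rw [hA] at hg
      have := hP.tail_one _ _ (adoptProb_nonneg x _) (adoptProb_le_one x _) (Nat.cast_nonneg _)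
        hg hQ2
      have h3 := roundE_outSize x A
        (fun N => if (N : ℝ) + P.f ≤ P.outBound 1 ∧ (N : ℝ) + P.f ≤ P.θ then 0 else 1)
      rw [h3]
      linarith
  · obtain ⟨i, hi, hmin⟩ := exists_opinionSize_eq_minSize hgood.1 x
    have htt : t < P.t₀ := by
      by_contra h; have := h1 (not_lt.1 h); omega
    refine ⟨_, fun c => ?_, fun c c' hc => potential_next_le hn hP hA hi hc, ?_⟩
    · have := sizePotential_nonneg (10 ^ 6 * n) (n / #A) (min (opinionSize c i + P.f) (n / #A))
      split_ifs <;> positivity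
    · rw [roundE_add, roundE_add, roundE_const, roundE_const_mul]
      simp only [potential]
      rw [if_pos ⟨hA, htt.le⟩, hcast]
      have h3 := roundE_outSize x A (fun N => if P.outBound #A < (N : ℝ) + P.f then 1 else 0)
      rw [h3]
      have h4 := hP.tail _ _ _ hA (Finset.card_le_card hAV) (adoptProb_nonneg x _)
        (adoptProb_le_one x _) (Nat.cast_nonneg _) hgood.2.1 hQ2
      have h5 := roundE_sizePotential_le hn hP hA hAV hgood hi hmin
      set ρ := 1 - 1 / 10 ^ 11 / (#P.valid : ℝ)
      have h6 : ρ ^ (P.t₀ - t) = ρ ^ (P.t₀ - (t + 1)) * ρ := by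
        rw [← pow_succ]; congr 1; omega
      rw [h6]
      have h7 := mul_le_mul_of_nonneg_left h5
        (show 0 ≤ ρ ^ (P.t₀ - (t + 1)) * (2 * n : ℝ) ^ #A * Real.sqrt n by positivity)
      calc _ ≤ δ + (((P.t₁ - (t + 1) : ℕ) : ℝ) * δ + ρ ^ (P.t₀ - (t + 1)) * (2 * n : ℝ) ^ #A
            * Real.sqrt n * (ρ * sizePotential (10 ^ 6 * n) (n / #A) (minSize A x))) :=
          add_le_add h4 (add_le_add_right h7 _)
        _ = _ := by ring

end Tracking

/-! ### The failure probability -/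

/-- The expectation over the first `t + 1` rounds, by conditioning on the first `t` rounds. -/
theorem tsum_historyLaw_succ {n : ℕ} [NeZero n] {S : Type*} {F : ℝ} (A : DynamicAdversary n S F)
    (x₀ : Config n S) (t : ℕ) (Φ : (Fin (t + 2) → Config n S × Config n S) → ENNReal) :
    ∑' h, historyLaw A x₀ (t + 1) h * Φ h
      = ∑' h, historyLaw A x₀ t h * ∑' c, threeMajorityStep (h (Fin.last t)).2 c
        * ∑' c', A.act (t + 1) h c c'
          * Φ (Fin.snoc (α := fun _ => Config n S × Config n S) h (c, c')) := by
  have bind_tsum : ∀ {α β : Type _} (p : PMF α) (f : α → PMF β) (g : β → ENNReal),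
      ∑' b, p.bind f b * g b = ∑' a, p a * ∑' b, f a b * g b := by
    intro α β p f g
    simp only [PMF.bind_apply, ← ENNReal.tsum_mul_right, ← ENNReal.tsum_mul_left]
    rw [ENNReal.tsum_comm]
    simp only [mul_assoc]
  have map_tsum : ∀ {α β : Type _} (p : PMF α) (f : α → β) (g : β → ENNReal),
      ∑' b, p.map f b * g b = ∑' a, p a * g (f a) := by
    intro α β p f g
    rw [PMF.map, bind_tsum]
    refine tsum_congr fun a => ?_
    rw [tsum_eq_single (f a)]
    · simp
    · intro b hb; simp [hb]
  rw [historyLaw, bind_tsum]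
  refine tsum_congr fun h => ?_
  rw [bind_tsum]
  congr 1
  refine tsum_congr fun c => ?_
  rw [map_tsum]

theorem tsum_mul_le_of_le {α : Type*} (p : PMF α) {g : α → ENNReal} {b : ENNReal}
    (h : ∀ a ∈ p.support, g a ≤ b) : ∑' a, p a * g a ≤ b := by
  calc ∑' a, p a * g a ≤ ∑' a, p a * b := by
        refine ENNReal.tsum_le_tsum fun a => ?_
        by_cases ha : a ∈ p.support
        · gcongr; exact h a ha
        · rw [PMF.apply_eq_zero_iff p a |>.2 ha]; simp
    _ = b := by rw [ENNReal.tsum_mul_right, p.tsum_coe, one_mul]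

namespace Tracking

variable {S : Type*} {P : Tracking S}

/-- The expected potential of the tracking does not increase. -/
theorem tsum_potential_succ_le {n : ℕ} [NeZero n] (hn : 2 ≤ n) {δ : ℝ} (hP : P.IsAdmissible n δ)
    {F : ℝ} (hF : P.f = ⌊F⌋₊) (A : DynamicAdversary n S F) (x₀ : Config n S) (t : ℕ) :
    ∑' h, historyLaw A x₀ (t + 1) h
        * ENNReal.ofReal (P.potential δ (t + 1) (P.tracked (t + 1) h) (h (Fin.last (t + 1))).2)
      ≤ ∑' h, historyLaw A x₀ t h
        * ENNReal.ofReal (P.potential δ t (P.tracked t h) (h (Fin.last t)).2) := by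
  classical
  rw [tsum_historyLaw_succ]
  refine ENNReal.tsum_le_tsum fun h => mul_le_mul_right ?_ _
  simp only [tracked, Fin.init_snoc, Fin.snoc_last]
  split_ifs with ht
  · cases hB : P.tracked t h with
    | none =>
      simp only [Option.bind_none]
      refine tsum_mul_le_of_le _ fun c _ => tsum_mul_le_of_le _ fun c' _ => ?_
      exact le_rfl
    | some B =>
      obtain ⟨-, h2, h3, h4, -⟩ := P.tracked_spec hP.lt t h hB
      obtain ⟨G, hG0, hG1, hG2⟩ := exists_roundE_le_potential hn hP (by omega) h2
        (h3 (by omega)) h4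
      simp only [Option.bind_some]
      refine le_trans ?_ (ENNReal.ofReal_le_ofReal hG2)
      rw [← tsum_threeMajorityStep _ hG0]
      refine ENNReal.tsum_le_tsum fun c => mul_le_mul_right ?_ _
      refine tsum_mul_le_of_le _ fun c' hc' => ENNReal.ofReal_le_ofReal (hG1 c c' ?_)
      have hch := A.card_changed_le (t + 1) h c c' hc'
      rw [hF]
      refine Nat.le_floor ?_
      convert hch
  · refine tsum_mul_le_of_le _ fun c _ => tsum_mul_le_of_le _ fun c' _ => ?_
    have := hP.lt
    cases P.tracked t h with
    | none => exact le_rfl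
    | some B =>
      refine ENNReal.ofReal_le_ofReal (le_of_eq ?_)
      simp only [potential]
      rw [if_neg (by omega), if_neg (by omega), show P.t₁ - (t + 1) = P.t₁ - t by omega]

/-- The potential at the end of round `0`. -/
theorem tsum_potential_zero_le {n : ℕ} [NeZero n] (hn : 2 ≤ n) {δ : ℝ} (hP : P.IsAdmissible n δ)
    {F : ℝ} (hF : P.f = ⌊F⌋₊) (A : DynamicAdversary n S F) (x₀ : Config n S)
    (hV : ↑P.valid = activeOpinions x₀) (ht₀ : 0 < P.t₀) :
    ∑' h, historyLaw A x₀ 0 h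
        * ENNReal.ofReal (P.potential δ 0 (P.tracked 0 h) (h (Fin.last 0)).2)
      ≤ ENNReal.ofReal (P.t₁ * δ + (1 - 1 / 10 ^ 11 / (#P.valid : ℝ)) ^ P.t₀
        * (2 * n : ℝ) ^ (#P.valid + 1)) := by
  classical
  refine tsum_mul_le_of_le _ fun h hh => ENNReal.ofReal_le_ofReal ?_
  rw [historyLaw, PMF.mem_support_map_iff] at hh
  obtain ⟨y, hy, rfl⟩ := hh
  have hδ := hP.delta_nonneg
  have hρ := hP.rate_nonneg
  have hn0 : (2 : ℝ) ≤ n := by exact_mod_cast hn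
  have hout : (outSize P.valid y : ℝ) ≤ P.f := by
    have h1 : outSize P.valid y ≤ outSize P.valid x₀ + P.f := by
      refine outSize_le_add_of_changed_le ?_ _
      rw [hF]
      refine Nat.le_floor ?_
      convert A.card_changed_le 0 _ x₀ y hy
    have h2 : outSize P.valid x₀ = 0 := by
      unfold outSize
      rw [Finset.card_eq_zero, Finset.filter_eq_empty_iff]
      intro v _
      rw [not_not, ← Finset.mem_coe, hV]
      exact ⟨v, rfl⟩
    rw [h2, zero_add] at h1
    exact_mod_cast h1
  have hk : (1 : ℝ) ≤ #P.valid := by exact_mod_cast hP.valid_nonempty.card_pos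
  have hLb : (P.f : ℝ) ≤ P.outBound #P.valid := by
    have hL := hP.L_nonneg
    refine hP.f_le.trans ?_
    unfold outBound
    rw [div_self (by positivity)]
    have h1 : P.L / #P.valid / #P.valid ≤ P.L :=
      (div_le_self (by positivity) hk).trans (div_le_self hL hk)
    have h2 : P.L / #P.valid / #P.valid / (2 * 10 ^ 12) ≤ P.L / #P.valid / #P.valid :=
      div_le_self (by positivity) (by norm_num)
    linarith
  have hpow : (0 : ℝ) ≤ (1 - 1 / 10 ^ 11 / (#P.valid : ℝ)) ^ P.t₀
        * (2 * n : ℝ) ^ (#P.valid + 1) := by positivity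
  have ht : (0 : ℝ) ≤ P.t₁ * δ := by positivity
  simp only [tracked]
  rcases hnext : P.next 0 P.valid y with _ | B
  · obtain ⟨B, hB, hB'⟩ := P.exists_good hP.valid_nonempty (hout.trans hLb)
    exact absurd ⟨hB, hB', fun _ => hout.trans hP.f_le_theta, fun h => by omega⟩
      (P.not_isNext_of_next_eq_none hnext B)
  · obtain ⟨h1, h2, -, -⟩ := P.isNext_of_next_eq_some hnext
    simp only [potential]
    split_ifs with h5
    · have hB1 : (1 : ℝ) ≤ #B := by exact_mod_cast h2.1.card_pos
      have h6 : Real.sqrt n * sizePotential (10 ^ 6 * n) (n / #B) (minSize B y) ≤ 2 * n :=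
        sqrt_mul_sizePotential_le hn (Nat.cast_nonneg _)
          ((minSize_le_avg h2.1 y).trans (div_le_self (by positivity) hB1))
      have h7 : (2 * n : ℝ) ^ #B ≤ (2 * n : ℝ) ^ #P.valid :=
        pow_le_pow_right₀ (by linarith) (Finset.card_le_card h1)
      rw [pow_succ (2 * n : ℝ) #P.valid, Nat.sub_zero, Nat.sub_zero]
      have h8 := sizePotential_nonneg (10 ^ 6 * n) (n / #B) (minSize B y)
      gcongr
    · rw [Nat.sub_zero]
      linarith

open Classical in
/-- The tracking of the competitors succeeds with high probability. -/
theorem le_toOuterMeasure {n : ℕ} [NeZero n] (hn : 2 ≤ n) {δ : ℝ} (hP : P.IsAdmissible n δ)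
    {F : ℝ} (hF : P.f = ⌊F⌋₊) (A : DynamicAdversary n S F) (x₀ : Config n S)
    (hV : ↑P.valid = activeOpinions x₀) (ht₀ : 0 < P.t₀) {N d : ℕ} {B : ℝ}
    (hB : (P.t₀ : ℝ) + 1 ≤ B) (hd : P.t₁ = P.t₀ + 1 + d) (hN : P.t₁ ≤ N) :
    1 - (P.t₁ * δ + (1 - 1 / 10 ^ 11 / (#P.valid : ℝ)) ^ P.t₀ * (2 * n : ℝ) ^ (#P.valid + 1))
      ≤ ((historyLaw A x₀ N).toOuterMeasure
          {h | ReachesStableAlmostConsensus P.θ x₀ B d h}).toReal := by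
  set E := {h : Fin (N + 1) → Config n S × Config n S |
    ReachesStableAlmostConsensus P.θ x₀ B d h} with hE
  set p := historyLaw A x₀ N
  set b := P.t₁ * δ + (1 - 1 / 10 ^ 11 / (#P.valid : ℝ)) ^ P.t₀ * (2 * n : ℝ) ^ (#P.valid + 1)
    with hb
  have hb0 : 0 ≤ b := by
    have := hP.delta_nonneg
    have := hP.rate_nonneg
    positivity
  have hall : ∀ t, ∑' h, historyLaw A x₀ t h
      * ENNReal.ofReal (P.potential δ t (P.tracked t h) (h (Fin.last t)).2)
        ≤ ENNReal.ofReal b := by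
    intro t
    induction t with
    | zero => exact tsum_potential_zero_le hn hP hF A x₀ hV ht₀
    | succ t ih => exact (tsum_potential_succ_le hn hP hF A x₀ t).trans ih
  have hfail : p.toOuterMeasure Eᶜ ≤ ENNReal.ofReal b := by
    refine le_trans ?_ (hall N)
    rw [PMF.toOuterMeasure_apply]
    refine ENNReal.tsum_le_tsum fun h => ?_
    by_cases hh : h ∈ Eᶜ
    · rw [Set.indicator_of_mem hh]
      have : P.tracked N h = none := by
        by_contra hcon
        exact hh (P.reachesStableAlmostConsensus hP.lt hV hB hd hN hcon)
      rw [this]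
      simp [potential, p]
    · rw [Set.indicator_of_notMem hh]
      exact zero_le
  have hsum : (1 : ENNReal) ≤ p.toOuterMeasure E + p.toOuterMeasure Eᶜ := by
    have h1 : p.toOuterMeasure Set.univ = 1 := by
      rw [PMF.toOuterMeasure_apply, Set.indicator_univ, p.tsum_coe]
    rw [← h1, ← Set.union_compl_self E]
    exact MeasureTheory.measure_union_le _ _
  have hle : p.toOuterMeasure E ≤ 1 := by
    rw [PMF.toOuterMeasure_apply, ← p.tsum_coe]
    exact ENNReal.tsum_le_tsum fun h => Set.indicator_le_self _ _ _
  have h2 : (1 : ENNReal) ≤ p.toOuterMeasure E + ENNReal.ofReal b :=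
    hsum.trans (add_le_add_right hfail _)
  have hne : p.toOuterMeasure E ≠ ⊤ := ne_top_of_le_ne_top ENNReal.one_ne_top hle
  have h3 := ENNReal.toReal_mono (ENNReal.add_ne_top.2 ⟨hne, ENNReal.ofReal_ne_top⟩) h2
  rw [ENNReal.toReal_add hne ENNReal.ofReal_ne_top, ENNReal.toReal_ofReal hb0,
    ENNReal.toReal_one] at h3
  linarith

end Tracking

/-! ### Two admissible choices of parameters -/

theorem binE_zero_prob (n : ℕ) (f : ℕ → ℝ) : binE 0 n f = f 0 := by
  induction n with
  | zero => rfl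
  | succ n ih => simp [binE, ih]

theorem exp_sub_one_le {s : ℝ} (h0 : 0 ≤ s) (h1 : s ≤ 1) : Real.exp s - 1 ≤ s + s ^ 2 := by
  have := Real.abs_exp_sub_one_sub_id_le (x := s) (by rw [abs_of_nonneg h0]; exact h1)
  have := (abs_le.1 this).2
  linarith

namespace Tracking

variable {S : Type*}

/-- An adversary that cannot change any node leaves no node outside the competition. -/
theorem isAdmissible_of_no_adversary (P : Tracking S) {n : ℕ} (hn : 2 ≤ n) {δ : ℝ} (hδ : 0 ≤ δ)
    (ht : P.t₀ < P.t₁) (hV : P.valid.Nonempty) (hL : P.L = 0) (hf : P.f = 0) (hθ : 0 ≤ P.θ) :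
    P.IsAdmissible n δ := by
  have hn0 : (0 : ℝ) < n := by exact_mod_cast (by omega : 0 < n)
  have hout : ∀ j, P.outBound j = 0 := fun j => by simp [outBound, hL]
  have hq : ∀ {Q q y : ℝ}, 0 ≤ q → 0 ≤ Q → Q ≤ 0 → n * q ≤ Q * y → q = 0 := by
    intro Q q y h0 hQ hQ0 h
    have : Q = 0 := le_antisymm hQ0 hQ
    rw [this, zero_mul] at h
    nlinarith
  refine ⟨hδ, ht, hV, hL.ge, by simp [hL, hf], by simpa [hf], by simp [hL], ?_, ?_⟩
  · intro j Q q _ _ h0 _ hQ hQb h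
    rw [hout] at hQb
    rw [hq h0 hQ hQb h, binE_zero_prob, hout, hf]
    simpa
  · intro Q q h0 _ hQ hQb h
    rw [hout] at hQb
    rw [hq h0 hQ hQb h, binE_zero_prob, hout, hf]
    simpa [hθ]

set_option maxHeartbeats 400000 in
/-- If `√n / k²` exceeds a large multiple of `log n`, then the nodes outside the competition
stay few with probability at least `1 - n ^ (-e)` in every round. -/
theorem isAdmissible_of_log_le (P : Tracking S) {n : ℕ} (hn : 2 ≤ n) {e : ℝ} (he : 0 ≤ e)
    (ht : P.t₀ < P.t₁) (hV : P.valid.Nonempty) (hL : P.L = Real.sqrt n / (8 * 10 ^ 12))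
    (hlog : 1 ≤ Real.log n)
    (hr : 32 * (8 * 10 ^ 12) * (e + 2) * Real.log n ≤ Real.sqrt n / (#P.valid : ℝ) ^ 2)
    (hf : (P.f : ℝ) ≤ P.L / #P.valid / #P.valid / (2 * 10 ^ 12))
    (hθ : P.f + Real.sqrt n / (#P.valid : ℝ) ^ 2 ≤ P.θ) :
    P.IsAdmissible n ((n : ℝ) ^ (-e)) := by
  have hn2 : (2 : ℝ) ≤ n := by exact_mod_cast hn
  have hn0 : (0 : ℝ) < n := by linarith
  have hk1 : (1 : ℝ) ≤ #P.valid := by exact_mod_cast hV.card_pos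
  obtain ⟨k, hk⟩ : ∃ k : ℝ, k = #P.valid := ⟨_, rfl⟩
  obtain ⟨s, hs⟩ : ∃ s : ℝ, s = Real.sqrt n := ⟨_, rfl⟩
  rw [← hk] at hr hf hθ hk1
  rw [← hs] at hL hr hθ
  have hs0 : 0 < s := by rw [hs]; exact Real.sqrt_pos.2 hn0
  have hs2 : s * s = n := by rw [hs]; exact Real.mul_self_sqrt hn0.le
  have hk0 : 0 < k := by linarith
  have hL0 : 0 < P.L := by rw [hL]; positivity
  have helog : 0 ≤ e * Real.log n := by positivity
  have hr0 : 0 ≤ s / k ^ 2 := by positivity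
  have hks : k ≤ s := by
    have h1 : 1 ≤ s / k ^ 2 := by nlinarith
    rw [le_div_iff₀ (by positivity)] at h1
    nlinarith
  have hfL : (P.f : ℝ) ≤ P.L / (8 * k) := by
    refine hf.trans ?_
    have : P.L / k / k ≤ P.L / k := div_le_self (by positivity) hk1
    calc P.L / k / k / (2 * 10 ^ 12) ≤ P.L / k / (2 * 10 ^ 12) := by gcongr
      _ ≤ P.L / k / 8 := by gcongr; norm_num
      _ = _ := by ring
  have hbound2 : ∀ j, P.outBound j ≤ 2 * P.L := by
    intro j
    unfold outBound
    have h : (0 : ℝ) ≤ j / #P.valid := by positivity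
    nlinarith
  have hbound1 : ∀ j : ℕ, j ≤ #P.valid → P.L ≤ P.outBound j := by
    intro j hj
    unfold outBound
    have h : (j : ℝ) / #P.valid ≤ 1 := by
      rw [← hk, div_le_one hk0, hk]; exact_mod_cast hj
    nlinarith
  have hrpow : ∀ {z : ℝ}, z ≤ -(e * Real.log n) → Real.exp z ≤ (n : ℝ) ^ (-e) := by
    intro z hz
    rw [Real.rpow_def_of_pos hn0]
    exact Real.exp_le_exp.2 (by linarith)
  have hw : ∀ {Q : ℝ}, 0 ≤ Q → Q ≤ 2 * P.L → 0 ≤ Q / n ∧ Q / n ≤ 1 / (4 * k) := by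
    intro Q h0 hQ
    refine ⟨by positivity, ?_⟩
    rw [div_le_div_iff₀ hn0 (by positivity)]
    have : Q * (4 * k) ≤ 2 * (s / (8 * 10 ^ 12)) * (4 * s) := by
      rw [← hL]; gcongr
    nlinarith
  refine ⟨by positivity, ht, hV, hL0.le, by rw [← hk]; exact hf, ?_, by rw [hL, ← hs]; linarith,
    ?_, ?_⟩
  · linarith
  · intro j Q q hj2 hjk h0 h1 hQ hQb h
    have hj0 : (2 : ℝ) ≤ j := by exact_mod_cast hj2
    have hjk' : (j : ℝ) ≤ k := by rw [hk]; exact_mod_cast hjk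
    obtain ⟨hw0, hw1⟩ := hw hQ (hQb.trans (hbound2 j))
    have hLb := hbound1 j hjk
    -- The nodes outside shrink by a factor `1 - 1 / (2 * k)` in expectation.
    have hnq : n * q ≤ P.outBound j * (1 - 1 / (2 * k)) := by
      have hkj : 1 / k ≤ 1 / (j : ℝ) := one_div_le_one_div_of_le (by linarith) hjk'
      have h2 : 1 + Q / n - (1 - Q / n) ^ 2 / j ≤ 1 - 1 / (2 * k) := by
        have h3 : (1 - 2 * (Q / n)) / j ≤ (1 - Q / n) ^ 2 / j := by
          gcongr; nlinarith [sq_nonneg (Q / n)]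
        have h4 : (1 - 2 * (Q / n)) / j = 1 / j - Q / n * (2 / j) := by ring
        have h5 : Q / n * (2 / j) ≤ Q / n * 1 := by
          gcongr; rw [div_le_one (by linarith)]; exact hj0
        have h6 : 1 / (2 * k) = 1 / k / 2 := by field_simp
        have h7 : 1 / (4 * k) = 1 / k / 4 := by field_simp
        linarith
      have h8 : 0 ≤ 1 - 1 / (2 * k) := by
        rw [sub_nonneg, div_le_one (by positivity)]; linarith
      calc n * q ≤ Q * (1 + Q / n - (1 - Q / n) ^ 2 / j) := h
        _ ≤ Q * (1 - 1 / (2 * k)) := by gcongr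
        _ ≤ _ := by gcongr
    have htail := binE_tail_le h0 h1 n (s := 1 / (4 * k)) (by positivity) (P.outBound j - P.f)
    have hs1 : 1 / (4 * k) ≤ 1 := by rw [div_le_one (by positivity)]; linarith
    have hexp := exp_sub_one_le (s := 1 / (4 * k)) (by positivity) hs1
    refine le_trans (le_of_eq ?_) (htail.trans (hrpow ?_))
    · congr 1
      ext N
      simp only [sub_lt_iff_lt_add]
    · have hnq0 : 0 ≤ n * q := by positivity
      have hOb0 : 0 ≤ P.outBound j := by linarith
      have h2 : n * q * (Real.exp (1 / (4 * k)) - 1)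
          ≤ P.outBound j * (1 - 1 / (2 * k)) * (1 / (4 * k) + (1 / (4 * k)) ^ 2) := by
        have h3 : (0 : ℝ) ≤ 1 / (4 * k) := by positivity
        have h4 := Real.add_one_le_exp (1 / (4 * k))
        exact mul_le_mul hnq hexp (by linarith) (hnq0.trans hnq)
      have h3 : P.outBound j * (1 - 1 / (2 * k)) * (1 / (4 * k) + (1 / (4 * k)) ^ 2)
          ≤ 1 / (4 * k) * P.outBound j - P.outBound j / (16 * k ^ 2) := by
        have : 1 / (4 * k) * P.outBound j - P.outBound j / (16 * k ^ 2)
            - P.outBound j * (1 - 1 / (2 * k)) * (1 / (4 * k) + (1 / (4 * k)) ^ 2)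
            = P.outBound j / (32 * k ^ 3) := by
          field_simp; ring
        have : 0 ≤ P.outBound j / (32 * k ^ 3) := by positivity
        linarith
      have h4 : 1 / (4 * k) * P.f ≤ P.L / (32 * k ^ 2) := by
        calc 1 / (4 * k) * P.f ≤ 1 / (4 * k) * (P.L / (8 * k)) := by gcongr
          _ = _ := by field_simp; norm_num
      have h5 : P.L / (16 * k ^ 2) ≤ P.outBound j / (16 * k ^ 2) := by gcongr
      have h6 : P.L / (16 * k ^ 2) = s / k ^ 2 / (16 * (8 * 10 ^ 12)) := by
        rw [hL]; field_simp
      have h7 : P.L / (32 * k ^ 2) = s / k ^ 2 / (32 * (8 * 10 ^ 12)) := by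
        rw [hL]; field_simp
      have h8 : e * Real.log n ≤ s / k ^ 2 / (32 * (8 * 10 ^ 12)) := by
        rw [le_div_iff₀ (by positivity)]; linarith
      linarith
  · intro Q q h0 h1 hQ hQb h
    have hQ2 := hQb.trans (hbound2 1)
    obtain ⟨hw0, hw1⟩ := hw hQ hQ2
    have hLb := hbound1 1 hV.card_pos
    have hnq : n * q ≤ 1 := by
      have h2 : Q * (1 + Q / n - (1 - Q / n) ^ 2) ≤ 3 * (Q * Q / n) := by
        have : 1 + Q / n - (1 - Q / n) ^ 2 ≤ 3 * (Q / n) := by nlinarith [sq_nonneg (Q / n)]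
        calc _ ≤ Q * (3 * (Q / n)) := by gcongr
          _ = _ := by ring
      have h3 : Q * Q / n ≤ 1 / 3 := by
        rw [div_le_iff₀ hn0, ← hs2]
        have h4 : Q ≤ s / 2 := by rw [hL] at hQ2; linarith
        have h5 := mul_self_le_mul_self hQ h4
        have h6 := mul_pos hs0 hs0
        linarith
      linarith
    have hu1 : s / k ^ 2 / (2 * (8 * 10 ^ 12)) ≤ P.outBound 1 - P.f := by
      have h2 : P.L / (8 * k) ≤ P.L / 8 := by gcongr; linarith
      have h3 : s / k ^ 2 ≤ s := div_le_self hs0.le (one_le_pow₀ hk1)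
      rw [hL] at h2 hLb hfL
      linarith
    have hu2 : s / k ^ 2 / (2 * (8 * 10 ^ 12)) ≤ P.θ - P.f := by linarith
    have htail := binE_tail_le h0 h1 n (s := 1) zero_le_one (s / k ^ 2 / (2 * (8 * 10 ^ 12)))
    refine le_trans (binE_mono h0 h1 n fun N => ?_) (htail.trans (hrpow ?_))
    · by_cases hN : s / k ^ 2 / (2 * (8 * 10 ^ 12)) < N
      · rw [if_pos hN]; split_ifs <;> norm_num
      · rw [if_neg hN, if_pos]
        rw [not_lt] at hN
        exact ⟨by linarith, by linarith⟩
    · have hexp := exp_sub_one_le (s := 1) zero_le_one le_rfl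
      have h2 : n * q * (Real.exp 1 - 1) ≤ 1 * (1 + 1 ^ 2) := by
        have : (0 : ℝ) ≤ Real.exp 1 - 1 := by linarith [Real.add_one_le_exp (1 : ℝ)]
        gcongr
      have h3 : (e + 2) * Real.log n ≤ s / k ^ 2 / (2 * (8 * 10 ^ 12)) := by
        rw [le_div_iff₀ (by positivity)]
        have : 0 ≤ (e + 2) * Real.log n := by positivity
        linarith
      have h4 : (e + 2) * Real.log n = e * Real.log n + 2 * Real.log n := by ring
      linarith

end Tracking

/-! ### Asymptotic estimates -/

theorem eventually_log_pow_le (M : ℝ) : ∃ n₀ : ℕ, ∀ n : ℕ, n₀ ≤ n →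
    M * Real.log n ^ 10 ≤ n := by
  have h1 := (Real.isLittleO_pow_log_id_atTop (n := 10)).bound (c := 1 / (|M| + 1)) (by positivity)
  obtain ⟨a, ha⟩ := Filter.eventually_atTop.1 h1
  refine ⟨⌈a⌉₊, fun n hn => ?_⟩
  have h2 := ha n ((Nat.le_ceil a).trans (by exact_mod_cast hn))
  rw [Real.norm_of_nonneg (by positivity), id, Real.norm_of_nonneg (by positivity),
    div_mul_eq_mul_div, one_mul, le_div_iff₀ (by positivity)] at h2
  have : M * Real.log n ^ 10 ≤ |M| * Real.log n ^ 10 := by gcongr; exact le_abs_self M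
  nlinarith [show 0 ≤ Real.log n ^ 10 by positivity]

theorem exists_forall_le_log (M : ℝ) : ∃ n₀ : ℕ, ∀ n : ℕ, n₀ ≤ n → M ≤ Real.log n := by
  obtain ⟨a, ha⟩ := Filter.eventually_atTop.1 (Real.tendsto_log_atTop.eventually_ge_atTop M)
  exact ⟨⌈a⌉₊, fun n hn => ha n ((Nat.le_ceil a).trans (by exact_mod_cast hn))⟩

/-- If the adversary can change at least one node, then `k` is so small that `√n / k ^ 2` exceeds
any multiple of `log n`. -/
theorem mul_log_le_sqrt_div_sq {β M : ℝ} (hM : 0 ≤ M) {n : ℕ} {k : ℝ} (hk : 1 ≤ k)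
    (hlog : 1 ≤ Real.log n) (hn : M ^ 10 * β ^ 8 * Real.log n ^ 10 ≤ n)
    (hF : 1 ≤ β * Real.sqrt n / (k ^ (5 / 2 : ℝ) * Real.log n)) :
    M * Real.log n ≤ Real.sqrt n / k ^ 2 := by
  have hk0 : 0 < k := by linarith
  have hs2 : Real.sqrt n ^ 2 = n := Real.sq_sqrt (Nat.cast_nonneg n)
  set s := Real.sqrt n with hs
  have hs0 : 0 ≤ s := Real.sqrt_nonneg _
  set K := k ^ (5 / 2 : ℝ) with hK
  have hK0 : 0 < K := Real.rpow_pos_of_pos hk0 _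
  have hK4 : K ^ 4 = k ^ 10 := by
    rw [hK, ← Real.rpow_natCast, ← Real.rpow_mul hk0.le, ← Real.rpow_natCast]
    norm_num
  have h1 : K ≤ β * s := by
    rw [le_div_iff₀ (by positivity), one_mul] at hF
    nlinarith
  have h2 : (M * Real.log n) ^ 5 * β ^ 4 ≤ s := by
    refine le_of_sq_le_sq ?_ hs0
    rw [hs2]
    refine le_trans (le_of_eq ?_) hn
    ring
  refine le_of_pow_le_pow_left₀ (n := 5) (by norm_num) (by positivity) ?_
  rw [div_pow, le_div_iff₀ (by positivity), ← pow_mul, ← hK4]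
  calc (M * Real.log n) ^ 5 * K ^ 4 ≤ (M * Real.log n) ^ 5 * (β * s) ^ 4 := by gcongr
    _ = ((M * Real.log n) ^ 5 * β ^ 4) * s ^ 4 := by ring
    _ ≤ s * s ^ 4 := by gcongr
    _ = s ^ 5 := by ring

/-- After `⌈10¹¹ k ((k + 1) log (2 n) + c log n)⌉` rounds the competition is over with probability
at least `1 - n ^ (-c)`. -/
theorem pow_mul_pow_le {n k t : ℕ} (hn : 2 ≤ n) (hk : 1 ≤ k) {c : ℝ}
    (ht : 10 ^ 11 * k * ((k + 1) * Real.log (2 * n) + c * Real.log n) ≤ t) :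
    (1 - 1 / 10 ^ 11 / (k : ℝ)) ^ t * (2 * n : ℝ) ^ (k + 1) ≤ (n : ℝ) ^ (-c) := by
  have hn0 : (0 : ℝ) < n := by exact_mod_cast (by omega : 0 < n)
  have hk0 : (1 : ℝ) ≤ k := by exact_mod_cast hk
  have h1 : (1 - 1 / 10 ^ 11 / (k : ℝ)) ^ t ≤ Real.exp (-(1 / 10 ^ 11 / k) * t) := by
    rw [mul_comm, Real.exp_nat_mul]
    refine pow_le_pow_left₀ ?_ (by linarith [Real.add_one_le_exp (-(1 / 10 ^ 11 / (k : ℝ)))]) t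
    have : 1 / 10 ^ 11 / (k : ℝ) ≤ 1 / 10 ^ 11 / 1 := by gcongr
    linarith
  have h2 : (2 * n : ℝ) ^ (k + 1) = Real.exp ((k + 1) * Real.log (2 * n)) := by
    rw [← Real.exp_log (show (0 : ℝ) < 2 * n by positivity), ← Real.exp_nat_mul, Real.log_exp]
    push_cast; rfl
  rw [h2, Real.rpow_def_of_pos hn0]
  refine (mul_le_mul_of_nonneg_right h1 (Real.exp_nonneg _)).trans ?_
  rw [← Real.exp_add]
  refine Real.exp_le_exp.2 ?_
  have h3 : (k + 1) * Real.log (2 * n) + c * Real.log n ≤ 1 / 10 ^ 11 / k * t := by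
    rw [div_div, div_mul_eq_mul_div, le_div_iff₀ (by positivity)]
    linarith
  linarith

end

theorem mainTheorem1 (α β : ℝ) (hα : α < 1) (hβ : 0 < β) :
    ∃ γ : ℝ, β < γ ∧ ∀ (d : ℕ) (c : ℝ), 0 < c → ∃ C : ℝ, 0 < C ∧
      ∀ (n : ℕ) [NeZero n], 2 ≤ n →
      ∀ (S : Type*) [Finite S] (x₀ : Config n S) (k : ℕ),
        k = (activeOpinions x₀).ncard → (k : ℝ) ≤ (n : ℝ) ^ α →
      ∀ (A : DynamicAdversary n S
          (β * Real.sqrt n / ((k : ℝ) ^ (5 / 2 : ℝ) * Real.log n))) (B : ℝ),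
        B = C * (((k : ℝ) ^ 2 * Real.sqrt (Real.log n) + k * Real.log n) * (k + Real.log n)) →
      ∀ N : ℕ, B + (n : ℝ) ^ d ≤ N →
        1 - C * (n : ℝ) ^ (-c) ≤
          ((historyLaw A x₀ N).toOuterMeasure
            {h | ReachesStableAlmostConsensus
              (γ * Real.sqrt n / (k : ℝ) ^ (3 / 2 : ℝ)) x₀ B (n ^ d) h}).toReal := by
  refine ⟨β + 1, by linarith, fun d c hc => ?_⟩
  -- `δ = n ^ (-e)` is the failure probability of a single round.
  obtain ⟨e, he⟩ : ∃ e : ℝ, e = c + d + 3 := ⟨_, rfl⟩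
  have he0 : 0 ≤ e := by rw [he]; positivity
  obtain ⟨M, hM⟩ : ∃ M : ℝ, M = 32 * (8 * 10 ^ 12) * (e + 2) := ⟨_, rfl⟩
  obtain ⟨n₁, hn₁⟩ := eventually_log_pow_le (M ^ 10 * β ^ 8)
  obtain ⟨n₂, hn₂⟩ := exists_forall_le_log (max 1 (16 * 10 ^ 24 * β))
  obtain ⟨C₁, hC₁⟩ : ∃ C₁ : ℝ, C₁ = 10 ^ 11 * (4 + c) + 2 := ⟨_, rfl⟩
  have hC₁0 : 0 < C₁ := by rw [hC₁]; positivity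
  obtain ⟨C, hC⟩ : ∃ C : ℝ, C = max (2 * C₁ + 2) (((max n₁ n₂ : ℕ) : ℝ) ^ c) := ⟨_, rfl⟩
  have hCC₁ : 2 * C₁ + 2 ≤ C := hC ▸ le_max_left _ _
  refine ⟨C, by linarith, fun n _ hn S _ x₀ k hk _ A B hB N hN => ?_⟩
  have hn0 : (0 : ℝ) < n := by exact_mod_cast (by omega : 0 < n)
  have hn2 : (2 : ℝ) ≤ n := by exact_mod_cast hn
  rcases lt_or_ge n (max n₁ n₂) with hsmall | hlarge
  · -- For small `n`, the probability bound is void.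
    have h1 : 1 ≤ C * (n : ℝ) ^ (-c) := by
      rw [Real.rpow_neg hn0.le, ← div_eq_mul_inv, one_le_div (by positivity)]
      refine le_trans ?_ (hC ▸ le_max_right _ _)
      have : (n : ℝ) ≤ (max n₁ n₂ : ℕ) := by exact_mod_cast hsmall.le
      gcongr
    exact le_trans (by linarith) ENNReal.toReal_nonneg
  have hlog := hn₂ n ((le_max_right _ _).trans hlarge)
  have hlog1 : 1 ≤ Real.log n := (le_max_left _ _).trans hlog
  have hlogβ : 16 * 10 ^ 24 * β ≤ Real.log n := (le_max_right _ _).trans hlog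
  have hpow := hn₁ n ((le_max_left _ _).trans hlarge)
  have hlogn : Real.log n ≤ n := by linarith [Real.log_le_sub_one_of_pos hn0]
  set V : Finset S := (Set.toFinite (activeOpinions x₀)).toFinset with hVdef
  have hVc : (V : Set S) = activeOpinions x₀ := Set.Finite.coe_toFinset _
  have hVk : #V = k := by rw [hk, Set.ncard_eq_toFinset_card _ (Set.toFinite _)]
  have hVne : V.Nonempty := by
    rw [← Finset.coe_nonempty, hVc]
    exact ⟨x₀ ⟨0, by omega⟩, _, rfl⟩
  have hk1 : 1 ≤ k := by rw [← hVk]; exact hVne.card_pos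
  have hk1' : (1 : ℝ) ≤ k := by exact_mod_cast hk1
  have hk0 : (0 : ℝ) < k := by linarith
  have hkn : (k : ℝ) ≤ n := by
    have h1 : ∑ i ∈ V, 1 ≤ ∑ i ∈ V, opinionSize x₀ i := by
      refine Finset.sum_le_sum fun i hi => ?_
      rw [← Finset.mem_coe, hVc] at hi
      obtain ⟨v, hv⟩ := hi
      classical
      exact Finset.card_pos.2 ⟨v, by simpa using hv⟩
    have h2 := sum_opinionSize V x₀
    rw [Finset.sum_const, smul_eq_mul, mul_one, hVk] at h1
    exact_mod_cast (by omega : k ≤ n)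
  obtain ⟨F, hF⟩ : ∃ F : ℝ, F = β * Real.sqrt n / ((k : ℝ) ^ (5 / 2 : ℝ) * Real.log n) :=
    ⟨_, rfl⟩
  have hs0 : 0 < Real.sqrt n := Real.sqrt_pos.2 hn0
  set θ : ℝ := (β + 1) * Real.sqrt n / (k : ℝ) ^ (3 / 2 : ℝ) with hθ
  have hθ0 : 0 ≤ θ := by positivity
  obtain ⟨t₀, ht₀⟩ : ∃ t₀ : ℕ, t₀ = ⌈10 ^ 11 * k * ((k + 1) * Real.log (2 * n)
    + c * Real.log n)⌉₊ := ⟨_, rfl⟩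
  have hlog2 : Real.log (2 * n) ≤ 2 * Real.log n := by
    rw [Real.log_mul two_ne_zero hn0.ne', two_mul]
    gcongr
  have hlog20 : 0 < Real.log (2 * n) := Real.log_pos (by linarith)
  have hceil : 0 < 10 ^ 11 * k * ((k + 1) * Real.log (2 * n) + c * Real.log n) := by positivity
  have ht₀pos : 0 < t₀ := by rw [ht₀]; exact Nat.ceil_pos.2 hceil
  -- The deadline for the competition is `O(k log n (k + log n))`.
  have ht₀le : (t₀ : ℝ) + 1 ≤ C₁ * (k * Real.log n * (k + Real.log n)) := by
    have h1 : (t₀ : ℝ) < 10 ^ 11 * k * ((k + 1) * Real.log (2 * n) + c * Real.log n) + 1 := by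
      rw [ht₀]; exact Nat.ceil_lt_add_one hceil.le
    have h2 : (k + 1) * Real.log (2 * n) + c * Real.log n ≤ (4 + c) * (k * Real.log n) := by
      have h3 : (k + 1) * Real.log (2 * n) ≤ (2 * k) * (2 * Real.log n) := by gcongr; linarith
      have h4 : c * (1 * Real.log n) ≤ c * (k * Real.log n) := by gcongr
      linarith
    have h5 : 10 ^ 11 * k * ((k + 1) * Real.log (2 * n) + c * Real.log n)
        ≤ 10 ^ 11 * k * ((4 + c) * (k * Real.log n)) := by gcongr
    have h6 : 1 ≤ k * Real.log n := one_le_mul_of_one_le_of_one_le hk1' hlog1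
    have h7 : k * Real.log n * k ≤ k * Real.log n * (k + Real.log n) := by gcongr; linarith
    have h8 : 1 ≤ k * Real.log n * (k + Real.log n) :=
      one_le_mul_of_one_le_of_one_le h6 (by linarith)
    have h9 : 10 ^ 11 * (4 + c) * (k * Real.log n * k)
        ≤ 10 ^ 11 * (4 + c) * (k * Real.log n * (k + Real.log n)) := by gcongr
    rw [hC₁]
    linarith
  have hpos : 0 ≤ k * Real.log n * (k + Real.log n) := by positivity
  have hBt : (t₀ : ℝ) + 1 ≤ B := by
    refine ht₀le.trans ?_
    rw [hB]
    have h1 : k * Real.log n * (k + Real.log n)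
        ≤ ((k : ℝ) ^ 2 * Real.sqrt (Real.log n) + k * Real.log n) * (k + Real.log n) := by
      gcongr
      exact le_add_of_nonneg_left (by positivity)
    calc C₁ * (k * Real.log n * (k + Real.log n)) ≤ C * (k * Real.log n * (k + Real.log n)) := by
          gcongr; linarith
      _ ≤ _ := by gcongr; linarith
  obtain ⟨t₁, ht₁⟩ : ∃ t₁ : ℕ, t₁ = t₀ + 1 + n ^ d := ⟨_, rfl⟩
  have ht₁N : t₁ ≤ N := by
    have : (t₁ : ℝ) ≤ N := by rw [ht₁]; push_cast; linarith
    exact_mod_cast this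
  have h32 : (k : ℝ) ^ (3 / 2 : ℝ) ≤ (k : ℝ) ^ 2 := by
    rw [← Real.rpow_natCast]
    exact Real.rpow_le_rpow_of_exponent_le hk1' (by norm_num)
  have h52 : (k : ℝ) ^ 2 ≤ (k : ℝ) ^ (5 / 2 : ℝ) := by
    rw [← Real.rpow_natCast]
    exact Real.rpow_le_rpow_of_exponent_le hk1' (by norm_num)
  set L : ℝ := if ⌊F⌋₊ = 0 then 0 else Real.sqrt n / (8 * 10 ^ 12) with hL
  set P : Tracking S := ⟨V, L, θ, ⌊F⌋₊, t₀, t₁⟩ with hP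
  have hadm : P.IsAdmissible n ((n : ℝ) ^ (-e)) := by
    by_cases hf : ⌊F⌋₊ = 0
    · exact P.isAdmissible_of_no_adversary hn (by positivity) (by simp only [hP]; omega) hVne
        (by simp [hP, hL, hf]) hf hθ0
    · have hF1 : 1 ≤ F := Nat.one_le_iff_ne_zero.2 hf |> Nat.floor_pos.1
      have hF0 : 0 ≤ F := by linarith
      have hfF : (⌊F⌋₊ : ℝ) ≤ F := Nat.floor_le hF0
      have hLs : L = Real.sqrt n / (8 * 10 ^ 12) := by rw [hL, if_neg hf]
      have hr := mul_log_le_sqrt_div_sq (M := M) (by rw [hM]; positivity) hk1' hlog1 hpow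
        (hF ▸ hF1)
      refine P.isAdmissible_of_log_le hn he0 (by simp only [hP]; omega) hVne hLs hlog1 ?_ ?_ ?_
      · simp only [hP, hVk]
        rw [← hM]; exact hr
      · simp only [hP, hVk]
        refine hfF.trans ?_
        rw [hLs, hF, div_div, div_div, div_div, div_le_div_iff₀ (by positivity) (by positivity)]
        have h1 : β * (16 * 10 ^ 24) * (k : ℝ) ^ 2 ≤ Real.log n * (k : ℝ) ^ (5 / 2 : ℝ) := by
          gcongr; linarith
        have h2 := mul_le_mul_of_nonneg_left h1 hs0.le
        linarith
      · simp only [hP, hVk]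
        have h1 : F ≤ β * (Real.sqrt n / (k : ℝ) ^ (3 / 2 : ℝ)) := by
          rw [hF, mul_div_assoc]
          gcongr
          exact (h32.trans h52).trans (le_mul_of_one_le_right (by positivity) hlog1)
        have h2 : Real.sqrt n / (k : ℝ) ^ 2 ≤ Real.sqrt n / (k : ℝ) ^ (3 / 2 : ℝ) := by gcongr
        have h3 : θ = β * (Real.sqrt n / (k : ℝ) ^ (3 / 2 : ℝ))
            + Real.sqrt n / (k : ℝ) ^ (3 / 2 : ℝ) := by rw [hθ]; ring
        linarith
  have hmain := Tracking.le_toOuterMeasure (P := P) hn hadm (by simp only [hP, hF]) A x₀ hVc ht₀pos (d := n ^ d) hBt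
    ht₁ ht₁N
  refine le_trans ?_ hmain
  simp only [hP, hVk]
  have hlast := pow_mul_pow_le (t := t₀) hn hk1 (c := c) (by rw [ht₀]; exact Nat.le_ceil _)
  have ht₁le : (t₁ : ℝ) ≤ (2 * C₁ + 1) * (n : ℝ) ^ (d + 3) := by
    have h1 : k * Real.log n * (k + Real.log n) ≤ n * n * (n + n) := by gcongr
    have h2 : (n : ℝ) * n * (n + n) ≤ 2 * (n : ℝ) ^ (d + 3) := by
      have : (n : ℝ) ^ 3 ≤ (n : ℝ) ^ (d + 3) := pow_le_pow_right₀ (by linarith) (by omega)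
      linarith
    have h3 : (n : ℝ) ^ d ≤ (n : ℝ) ^ (d + 3) := pow_le_pow_right₀ (by linarith) (by omega)
    have h4 := mul_le_mul_of_nonneg_left (h1.trans h2) hC₁0.le
    rw [ht₁]; push_cast
    linarith
  have hδ : (n : ℝ) ^ (d + 3) * (n : ℝ) ^ (-e) = (n : ℝ) ^ (-c) := by
    rw [← Real.rpow_natCast, ← Real.rpow_add hn0, he]
    congr 1; push_cast; ring
  have hfirst : (t₁ : ℝ) * (n : ℝ) ^ (-e) ≤ (2 * C₁ + 1) * (n : ℝ) ^ (-c) := by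
    rw [← hδ, ← mul_assoc]
    gcongr
  have hnc : 0 ≤ (n : ℝ) ^ (-c) := by positivity
  have := mul_le_mul_of_nonneg_right hCC₁ hnc
  linarith
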